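/- **Setting.** Words are finite sequences $w=(\omega_1,\dots,\omega_r)$ of positive integers. $\mathbf{Hqsh}$ is the real vector space with basis the words, with the quasi-shuffle product $a u\star b v=a(u\star bv)+b(au\star v)+(a+b)(u\star v)$ (the empty word $\emptyset$ is the unit) and the deconcatenation coproduct; $*$ is the resulting convolution, $e$ its unit ($e(\emptyset)=1$, $e(w)=0$ otherwise), $\mathrm{rev}$ is reversal of words, and $\iota(w)=1$ if $w$ has length $\le 1$, $\iota(w)=0$ otherwise. A *character* is a unital multiplicative linear form $\mathbf{Hqsh}\to\mathbb C$. A character $\phi$ *solves the algebraic problem of averages* if $\phi^{*-1}*\psi=\iota$, where $\psi$ is the character with $\psi^{*-1}=\overline{\phi}\circ\mathrm{rev}$. $\mathbf{Hck}$ is the real algebra with basis the non-planar rooted forests decorated by positive integers, with disjoint union as product. $\alpha:\mathbf{Hck}\to\mathbf{Hqsh}$ is the algebra morphism with $\alpha(B^+_\eta\Phi)=\eta\,\alpha(\Phi)$, where $B^+_\eta\Phi$ is the tree obtained by grafting the forest $\Phi$ on a root $\eta$ and $\eta\,\cdot$ is left concatenation. A solution $\phi$ of the algebraic problem *solves the analytic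 problem of averages* if $\phi\circ\alpha$ has geometric growth: there are $c,d>0$ with $|\phi(\alpha(\Phi))|\le c\,d^{\|\Phi\|}$ for every forest $\Phi$, where $\|\Phi\|$ is the sum of the decorations of $\Phi$. Let $A$ be a commutative unital real algebra with an augmentation $\varepsilon:A\to\mathbb R$ (an algebra morphism), $R:A\to A$ linear, $\tilde R=\mathrm{id}-R$, $\theta,\sigma:A\to A$ maps, $\Theta:A\to\mathbb C$ a unital algebra morphism, and $\gamma\in A$ with $\varepsilon(\gamma)=0$. For $f:\mathbf{Hqsh}\to A$ linear put $\mathcal R(f)=R\circ f$. Let $a:\mathbf{Hqsh}\to A$ be $a(\omega)=\gamma^\omega$ on one-letter words and $0$ on the other words. Put $(\mathcal Ra)^{[0]}=(\mathcal Ra)^{\{0\}}=e$, $(\mathcal Ra)^{[n+1]}=\mathcal R\big((\mathcal Ra)^{[n]}*a\big)$, $(\mathcal Ra)^{\{n+1\}}=\mathcal R\big(a*(\mathcal Ra)^{\{n\}}\big)$, and $F=\sum_n(-1)^n(\mathcal Ra)^{[n]}$. $(A,R,\theta,\sigma,\Theta,\gamma)$ is an *average algebra* if: 1. $R(f)R(g)=R(R(f)g+fR(g)-fg)$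 for all $f,g\in A$ (Rota-Baxter operator of weight $-1$), and $R\circ R=R$; 2. $\sigma(\gamma^n b)=\gamma^n\sigma(b)$ for $b\in\mathrm{Im}\,\tilde R$, $n\in\mathbb N$; 3. $\Theta(\gamma)=1$; 4. $\theta(\tilde R(b))\equiv R(\sigma(b))\bmod\ker\Theta$ for all $b\in\ker\varepsilon$; 5. $\sigma(\gamma)=\gamma$; 6. $R(\gamma^n\tilde R(\sigma(b)))=0$ for $b\in\mathrm{Im}\,\tilde R$, $n\in\mathbb N$. With a multiplicative morphism $v:A\to A$ it is a *well-behaved Rota-Baxter algebra* if moreover there is $k>0$ such that $$|\Theta(b)|\le|\Theta(v(b))|,\qquad |\Theta(v(R(\gamma^m b)))|\le k^m\,|\Theta(v(b))|\qquad(m\in\mathbb N)$$ for all the elements $b$ of $A$ of the form $(\mathcal Ra)^{\{n\}}(\alpha(\Phi))$ or $F(\mathrm{rev}(\alpha(\Phi)))$, with $n\in\mathbb N$ and $\Phi$ a forest. **Theorem (organic, $v=\mathrm{id}$).** Let $A=\mathbb R[x,y]$, $\varepsilon(P)=P(0,0)$, let $R$ be the linear map with $R(x^my^n)=\frac{m}{m+n}x^{m+n}$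 if $m+n\neq0$ and $R(1)=1$, and let $\theta(P)=P(x,x)$, $\sigma(P)=P(y,x)$, $\gamma=xy$, $\Theta(P)=P(1,1)$. Then $(A,R,\theta,\sigma,\Theta,\gamma,\mathrm{id}_A)$ is a well-behaved Rota-Baxter algebra. Moreover the two displayed inequalities hold with $k=1$ for every $b\in\mathrm{Im}\,R$ with nonnegative coefficients. The organic average $\phi_{\mathrm{organic}}=\Theta\circ F$ is given by $$\phi_{\mathrm{organic}}(\omega_1,\dots,\omega_r)=\prod_{i=1}^r\Big(\frac{\omega_i}{2(\omega_1+\dots+\omega_i)}-1\Big),$$ it is a character, and it solves both the algebraic and the analytic problem of averages. -/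

import Mathlib

noncomputable section

namespace WBA

/-! ### The quasi-shuffle algebra on words over the semigroup of positive integers -/

/-- The real vector space with basis the words in the letters `1, 2, 3, …`. -/
def Hqsh : Type := List ℕ+ →₀ ℝ

namespace Hqsh

instance : AddCommGroup Hqsh := inferInstanceAs (AddCommGroup (List ℕ+ →₀ ℝ))

instance : Module ℝ Hqsh := inferInstanceAs (Module ℝ (List ℕ+ →₀ ℝ))

/-- The basis vector given by a word. -/
def word (w : List ℕ+) : Hqsh := (Finsupp.single w (1 : ℝ) : List ℕ+ →₀ ℝ)

/-- The linear map with prescribed values on words. -/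
def ofWords {M : Type*} [AddCommGroup M] [Module ℝ M] (f : List ℕ+ → M) : Hqsh →ₗ[ℝ] M :=
  (Finsupp.linearCombination ℝ f : (List ℕ+ →₀ ℝ) →ₗ[ℝ] M)

@[simp] theorem ofWords_word {M : Type*} [AddCommGroup M] [Module ℝ M] (f : List ℕ+ → M)
    (w : List ℕ+) : ofWords f (word w) = f w := by
  have h := Finsupp.linearCombination_single ℝ (v := f) (1 : ℝ) w
  rw [one_smul] at h
  exact h

theorem hom_ext {M : Type*} [AddCommGroup M] [Module ℝ M] {f g : Hqsh →ₗ[ℝ] M}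
    (h : ∀ w, f (word w) = g (word w)) : f = g :=
  Finsupp.lhom_ext' fun w => LinearMap.ext_ring (h w)

/-- Left concatenation of a letter, `w ↦ a w`. -/
def consL (a : ℕ+) : Hqsh →ₗ[ℝ] Hqsh := ofWords fun w => word (a :: w)

/-- The quasi-shuffle of two words:
`au ⧢ bv = a (u ⧢ bv) + b (au ⧢ v) + (a + b) (u ⧢ v)`. -/
def qsh : List ℕ+ → List ℕ+ → Hqsh
  | [], v => word v
  | a :: u, [] => word (a :: u)
  | a :: u, b :: v =>
      consL a (qsh u (b :: v)) + consL b (qsh (a :: u) v) + consL (a + b) (qsh u v)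
  termination_by u v => u.length + v.length

/-- The bilinear extension of the quasi-shuffle of words. -/
def mulB : Hqsh →ₗ[ℝ] Hqsh →ₗ[ℝ] Hqsh := ofWords fun u => ofWords fun v => qsh u v

instance : Mul Hqsh := ⟨fun x y => mulB x y⟩

instance : One Hqsh := ⟨word []⟩

theorem mul_def (x y : Hqsh) : x * y = mulB x y := rfl

theorem one_def : (1 : Hqsh) = word [] := rfl

theorem word_mul_word (u v : List ℕ+) : word u * word v = qsh u v := by
  rw [mul_def, mulB, ofWords_word, ofWords_word]

theorem qsh_nil_right (u : List ℕ+) : qsh u [] = word u := by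
  cases u <;> simp [qsh]

theorem qsh_comm (u v : List ℕ+) : qsh u v = qsh v u := by
  induction u, v using qsh.induct with
  | case1 v => rw [qsh_nil_right, qsh]
  | case2 a u => rw [qsh, qsh]
  | case3 a u b v h1 h2 h3 =>
    rw [qsh, qsh, h1, h2, h3, add_comm a b]
    abel

theorem consL_mul_consL (a b : ℕ+) (x y : Hqsh) :
    consL a x * consL b y =
      consL a (x * consL b y) + consL b (consL a x * y) + consL (a + b) (x * y) := by
  have h : mulB.compl₁₂ (consL a) (consL b) =
      (mulB.compl₁₂ LinearMap.id (consL b)).compr₂ (consL a) +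
      (mulB.compl₁₂ (consL a) LinearMap.id).compr₂ (consL b) + mulB.compr₂ (consL (a + b)) := by
    refine hom_ext fun u => hom_ext fun v => ?_
    simp [consL, mulB, qsh]
  exact LinearMap.congr_fun₂ h x y

theorem mulB_comm (x y : Hqsh) : mulB x y = mulB y x := by
  have h : mulB = mulB.flip := by
    refine hom_ext fun u => hom_ext fun v => ?_
    simp [mulB, qsh_comm u v]
  exact LinearMap.congr_fun₂ h x y

theorem mulB_one_left (x : Hqsh) : mulB (word []) x = x := by
  have h : mulB (word []) = LinearMap.id := by
    refine hom_ext fun u => ?_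
    simp [mulB, qsh]
  exact LinearMap.congr_fun h x

theorem consL_word (a : ℕ+) (u : List ℕ+) : consL a (word u) = word (a :: u) := by simp [consL]

theorem add_mul_aux (x y z : Hqsh) : (x + y) * z = x * z + y * z := by
  simp [mul_def]

theorem mul_add_aux (x y z : Hqsh) : x * (y + z) = x * y + x * z := by
  simp [mul_def]

theorem word_assoc (n : ℕ) : ∀ u v w : List ℕ+, u.length + v.length + w.length ≤ n →
    word u * word v * word w = word u * (word v * word w) := by
  induction n with
  | zero =>
    intro u v w h
    obtain rfl : u = [] := List.length_eq_zero_iff.mp (by omega)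
    simp [mul_def, mulB_one_left]
  | succ n ih =>
    intro u v w h
    match u, v, w with
    | [], v, w => simp [mul_def, mulB_one_left]
    | a :: u, [], w =>
      rw [mul_def (word (a :: u)) (word []), mulB_comm, mulB_one_left, mul_def (word []),
        mulB_one_left]
    | a :: u, b :: v, [] =>
      rw [mul_def _ (word []), mulB_comm, mulB_one_left, mul_def _ (word []), mulB_comm (word _),
        mulB_one_left]
    | a :: u, b :: v, c :: w =>
      simp only [List.length_cons] at h
      have e1 := ih u (b :: v) (c :: w) (by simp; omega)
      have e2 := ih (a :: u) v (c :: w) (by simp; omega)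
      have e3 := ih (a :: u) (b :: v) w (by simp; omega)
      have e4 := ih u v (c :: w) (by simp; omega)
      have e5 := ih u (b :: v) w (by simp; omega)
      have e6 := ih (a :: u) v w (by simp; omega)
      have e7 := ih u v w (by omega)
      have f3 := congrArg (consL c) e3
      have f1 := congrArg (consL a) e1
      simp only [← consL_word] at e1 e2 e3 e4 e5 e6 f1 f3 ⊢
      simp only [consL_mul_consL, add_mul_aux, mul_add_aux, map_add, add_assoc] at f1 f3 ⊢
      simp only [e2, e4, e5, e6, e7] at f1 f3 ⊢
      rw [f1, ← f3]
      abel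

theorem mulB_assoc (x y z : Hqsh) : mulB (mulB x y) z = mulB x (mulB y z) := by
  have h1 : ∀ u v, mulB (mulB (word u) (word v)) = mulB (word u) ∘ₗ mulB (word v) :=
    fun u v => hom_ext fun w => word_assoc _ u v w le_rfl
  have h2 : ∀ u, mulB.flip z ∘ₗ mulB (word u) = mulB (word u) ∘ₗ mulB.flip z :=
    fun u => hom_ext fun v => LinearMap.congr_fun (h1 u v) z
  have h3 : mulB.flip z ∘ₗ mulB.flip y = mulB.flip (mulB y z) :=
    hom_ext fun u => LinearMap.congr_fun (h2 u) y
  exact LinearMap.congr_fun h3 x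

instance : CommRing Hqsh where
  __ := (inferInstance : AddCommGroup Hqsh)
  mul_assoc := mulB_assoc
  mul_comm := mulB_comm
  one_mul := mulB_one_left
  mul_one x := (mulB_comm x (word [])).trans (mulB_one_left x)
  left_distrib := mul_add_aux
  right_distrib := add_mul_aux
  zero_mul x := by simp [mul_def]
  mul_zero x := by simp [mul_def]

instance : Algebra ℝ Hqsh :=
  Algebra.ofModule (fun r x y => by simp [mul_def]) (fun r x y => by simp [mul_def])

/-- Reversal of words. -/
def rev : Hqsh →ₗ[ℝ] Hqsh := ofWords fun w => word w.reverse

section Convolution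

variable {A : Type*} [Ring A] [Algebra ℝ A]

/-- The convolution product attached to deconcatenation,
`(f ⋆ g)(w) = ∑ f(u) g(v)` over the factorizations `w = uv`. -/
def conv (f g : Hqsh →ₗ[ℝ] A) : Hqsh →ₗ[ℝ] A :=
  ofWords fun w => ∑ i ∈ Finset.range (w.length + 1), f (word (w.take i)) * g (word (w.drop i))

variable (A) in
/-- The unit of convolution: `1` on the empty word, `0` on the other words. -/
def convOne : Hqsh →ₗ[ℝ] A := ofWords fun w => if w = [] then (1 : A) else 0

end Convolution

end Hqsh

open Hqsh

/-- A character of the quasi-shuffle algebra with values in `ℂ`. -/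
def IsCharacter (φ : Hqsh →ₗ[ℝ] ℂ) : Prop :=
  φ 1 = 1 ∧ ∀ x y, φ (x * y) = φ x * φ y

/-- The character `ι`: `1` on the words of length at most one, `0` on the others. -/
def iota : Hqsh →ₗ[ℝ] ℂ := ofWords fun w => if w.length ≤ 1 then (1 : ℂ) else 0

/-- The complex conjugate of a linear form. -/
def conjForm (φ : Hqsh →ₗ[ℝ] ℂ) : Hqsh →ₗ[ℝ] ℂ := Complex.conjAe.toLinearMap ∘ₗ φ

/-- `g` is the inverse of `f` for convolution. -/
def IsConvInverse (f g : Hqsh →ₗ[ℝ] ℂ) : Prop :=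
  conv f g = convOne ℂ ∧ conv g f = convOne ℂ

/-- The algebraic problem of averages: `φ` is a character and `φ⁻¹ ⋆ ψ = ι`, where `ψ` is the
character with `ψ⁻¹ = conj φ ∘ rev`, inverses being taken for convolution. -/
def SolvesAlgebraicProblem (φ : Hqsh →ₗ[ℝ] ℂ) : Prop :=
  IsCharacter φ ∧ ∃ φinv ψ : Hqsh →ₗ[ℝ] ℂ,
    IsCharacter φinv ∧ IsCharacter ψ ∧ IsConvInverse φ φinv ∧
    IsConvInverse ψ (conjForm φ ∘ₗ rev) ∧ conv φinv ψ = iota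

/-! ### Non-planar decorated rooted trees and forests, and arborification -/

/-- A root decoration together with a multiset of subtrees. -/
def NodeF (X : Type) : Type := ℕ+ × Multiset X

instance : Functor NodeF where
  map f p := (p.1, p.2.map f)

instance : QPF NodeF where
  P := ⟨ℕ+ × ℕ, fun s => Fin s.2⟩
  abs x := (x.1.1, (List.ofFn x.2 : Multiset _))
  repr p := ⟨(p.1, p.2.toList.length), p.2.toList.get⟩
  abs_repr p := by
    refine Prod.ext rfl ?_
    change ((List.ofFn p.2.toList.get : List _) : Multiset _) = p.2
    rw [List.ofFn_get, Multiset.coe_toList]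
  abs_map f x := by
    refine Prod.ext rfl ?_
    change ((List.ofFn (f ∘ x.2) : List _) : Multiset _) = Multiset.map f (List.ofFn x.2 : List _)
    rw [Multiset.map_coe, List.map_ofFn]

/-- Non-planar rooted trees with nodes decorated by positive integers: the initial algebra of
`X ↦ ℕ+ × Multiset X`. -/
def Tree : Type := QPF.Fix NodeF

/-- Decorated forests: finite multisets of decorated trees. -/
abbrev Forest : Type := Multiset Tree

/-- The tree with root decoration `η` whose root is joined to the roots of the trees of `F`. -/
def graft (η : ℕ+) (F : Forest) : Tree := QPF.Fix.mk (F := NodeF) (η, F)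

/-- Recursion on trees. -/
def Tree.fold {X : Type} (g : ℕ+ → Multiset X → X) : Tree → X :=
  QPF.Fix.rec (F := NodeF) fun p => g p.1 p.2

theorem Tree.fold_graft {X : Type} (g : ℕ+ → Multiset X → X) (η : ℕ+) (F : Forest) :
    Tree.fold g (graft η F) = g η (F.map (Tree.fold g)) :=
  QPF.Fix.rec_eq (F := NodeF) (fun p => g p.1 p.2) (η, F)

theorem Tree.induction {p : Tree → Prop}
    (h : ∀ (η : ℕ+) (F : Forest), (∀ T ∈ F, p T) → p (graft η F)) (T : Tree) : p T := by
  refine QPF.Fix.ind (F := NodeF) p ?_ T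
  rintro ⟨η, F⟩ ⟨u, hu⟩
  refine h η F fun T hT => ?_
  have h2 : u.2.map Subtype.val = F := congrArg Prod.snd hu
  rw [← h2] at hT
  obtain ⟨S, -, rfl⟩ := Multiset.mem_map.mp hT
  exact S.2

/-- The sum of the decorations of the nodes of a tree. -/
def Tree.norm : Tree → ℕ := Tree.fold fun η s => (η : ℕ) + s.sum

/-- The sum of the decorations of the nodes of a forest. -/
def Forest.norm (F : Forest) : ℕ := (F.map Tree.norm).sum

/-- The (Connes-Kreimer) algebra of decorated forests: linear combinations of forests, with
disjoint union as product. -/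
abbrev Hck : Type := AddMonoidAlgebra ℝ Forest

/-- The basis vector given by a forest. -/
def forest (F : Forest) : Hck := AddMonoidAlgebra.single F 1

/-- The arborification of a tree: `α (B⁺_η F) = η α(F)`. -/
def arbTree : Tree → Hqsh := Tree.fold fun η s => consL η s.prod

/-- The arborification morphism `α : Hck → Hqsh`, the algebra morphism such that
`α ∘ B⁺_η = L_η ∘ α` with `L_η` the left concatenation of `η`. -/
def arborification : Hck →ₐ[ℝ] Hqsh :=
  AddMonoidAlgebra.lift ℝ Hqsh Forest
    { toFun := fun F => (F.toAdd.map arbTree).prod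
      map_one' := by simp
      map_mul' := fun F G => by simp }

theorem arborification_forest (F : Forest) :
    arborification (forest F) = (F.map arbTree).prod := by
  simp [arborification, forest]
  rfl

theorem arborification_graft (η : ℕ+) (F : Forest) :
    arborification (forest {graft η F}) = consL η (arborification (forest F)) := by
  rw [arborification_forest, arborification_forest, Multiset.map_singleton,
    Multiset.prod_singleton, arbTree, Tree.fold_graft]

/-- Geometrical growth of a linear form on decorated forests. -/
def HasGeometricGrowth (κ : Hck →ₗ[ℝ] ℂ) : Prop :=
  ∃ a b : ℝ, 0 < a ∧ 0 < b ∧ ∀ F : Forest, ‖κ (forest F)‖ ≤ a * b ^ F.norm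

/-- The contracted arborification `φ ∘ α`. -/
def contractedArborification (φ : Hqsh →ₗ[ℝ] ℂ) : Hck →ₗ[ℝ] ℂ := φ ∘ₗ arborification.toLinearMap

/-- The analytic problem of averages: `φ` solves the algebraic problem, and its contracted
arborification has geometrical growth. -/
def SolvesAnalyticProblem (φ : Hqsh →ₗ[ℝ] ℂ) : Prop :=
  SolvesAlgebraicProblem φ ∧ HasGeometricGrowth (contractedArborification φ)

/-! ### Rota-Baxter algebras, Atkinson recursion, average algebras -/

section RotaBaxter

variable {A : Type*} [CommRing A] [Algebra ℝ A]

/-- The Rota-Baxter relation of weight `c`. -/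
def IsRotaBaxter (c : ℝ) (R : A →ₗ[ℝ] A) : Prop :=
  ∀ x y, R x * R y = R (R x * y + x * R y + c • (x * y))

/-- The complementary operator `-c • id - R` of a Rota-Baxter operator of weight `c = -1`. -/
def complR (R : A →ₗ[ℝ] A) : A →ₗ[ℝ] A := LinearMap.id - R

/-- The morphism `I`: `1` on the empty word, `γ ^ ω` on a one-letter word `ω`, and `0` on the
longer words. -/
def calI (γ : A) : Hqsh →ₗ[ℝ] A := ofWords fun
  | [] => 1
  | [ω] => γ ^ (ω : ℕ)
  | _ => 0

/-- The element `a = I - e` to which the recursion is applied. -/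
def atkA (γ : A) : Hqsh →ₗ[ℝ] A := calI γ - convOne A

/-- `(Ra)^[0] = e`, `(Ra)^[n+1] = R ∘ ((Ra)^[n] ⋆ a)`. -/
def bracketPow (R : A →ₗ[ℝ] A) (a : Hqsh →ₗ[ℝ] A) : ℕ → (Hqsh →ₗ[ℝ] A)
  | 0 => convOne A
  | n + 1 => R ∘ₗ conv (bracketPow R a n) a

/-- `(Ra)^{0} = e`, `(Ra)^{n+1} = R ∘ (a ⋆ (Ra)^{n})`. -/
def bracePow (R : A →ₗ[ℝ] A) (a : Hqsh →ₗ[ℝ] A) : ℕ → (Hqsh →ₗ[ℝ] A)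
  | 0 => convOne A
  | n + 1 => R ∘ₗ conv a (bracePow R a n)

theorem bracketPow_word_eq_zero (R : A →ₗ[ℝ] A) (γ : A) (n : ℕ) :
    ∀ w : List ℕ+, w.length < n → bracketPow R (atkA γ) n (word w) = 0 := by
  induction n with
  | zero => intro w h; exact absurd h (Nat.not_lt_zero _)
  | succ n ih =>
    intro w h
    simp only [bracketPow, LinearMap.comp_apply, conv, ofWords_word]
    rw [Finset.sum_eq_zero, map_zero]
    intro i hi
    rw [Finset.mem_range] at hi
    rcases Nat.lt_or_ge i n with hin | hin
    · rw [ih _ (by rw [List.length_take]; omega), zero_mul]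
    · have h0 : w.drop i = [] := List.drop_eq_nil_iff.mpr (by omega)
      rw [h0]
      simp [atkA, calI, convOne]

/-- The series `F = ∑ t ^ n (Ra)^[n]` at `t = -1`, for `a = I - e`. On a word `w` the terms with
`n > length w` vanish, by `bracketPow_word_eq_zero`. -/
def atkF (R : A →ₗ[ℝ] A) (γ : A) : Hqsh →ₗ[ℝ] A := ofWords fun w =>
  ∑ n ∈ Finset.range (w.length + 1), (-1 : ℝ) ^ n • bracketPow R (atkA γ) n (word w)

/-- The linear form `φ = Θ ∘ F` at `t = -1`, produced by the Atkinson recursion. -/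
def atkPhi (R : A →ₗ[ℝ] A) (Θ : A →ₐ[ℝ] ℂ) (γ : A) : Hqsh →ₗ[ℝ] ℂ := Θ.toLinearMap ∘ₗ atkF R γ

/-- Average algebras. Here `A` is augmented by `ε`, and the relation `θ ∘ complR R = R ∘ σ` modulo
`ker Θ` is imposed on the augmentation ideal `ker ε`, which contains `γ`. (It cannot hold at `1`
in a case such as `R 1 = 1`, `θ 0 = 0`, `σ 1 = 1`.) -/
structure IsAverageAlgebra (ε : A →ₐ[ℝ] ℝ) (R : A →ₗ[ℝ] A) (θ σ : A → A) (Θ : A →ₐ[ℝ] ℂ)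
    (γ : A) : Prop where
  rotaBaxter : IsRotaBaxter (-1) R
  idempotent : ∀ x, R (R x) = R x
  sigma_mul : ∀ b ∈ LinearMap.range (complR R), ∀ n : ℕ, σ (γ ^ n * b) = γ ^ n * σ b
  Theta_gamma : Θ γ = 1
  eps_gamma : ε γ = 0
  theta_compl : ∀ b, ε b = 0 → θ (complR R b) - R (σ b) ∈ RingHom.ker Θ
  sigma_gamma : σ γ = γ
  compl_sigma : ∀ b ∈ LinearMap.range (complR R), ∀ n : ℕ, R (γ ^ n * complR R (σ b)) = 0

/-- The elements of `A` met in the recursion on forests: the values at forests of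
`(Ra)^{n} ∘ α`, and those of `H ∘ α`, where `H = F ∘ rev` at `t = -1`. -/
def recursionElements (R : A →ₗ[ℝ] A) (γ : A) : Set A :=
  {b | ∃ F : Forest, (∃ n, b = bracePow R (atkA γ) n (arborification (forest F))) ∨
    b = atkF R γ (rev (arborification (forest F)))}

/-- The growth inequalities of well-behaved Rota-Baxter algebras, with constant `k`, for the
elements of `T`. -/
def GrowthOn (T : Set A) (k : ℝ) (R : A →ₗ[ℝ] A) (Θ : A →ₐ[ℝ] ℂ) (γ : A) (v : A →* A) : Prop :=
  ∀ m : ℕ, ∀ b ∈ T, ‖Θ b‖ ≤ ‖Θ (v b)‖ ∧ ‖Θ (v (R (γ ^ m * b)))‖ ≤ k ^ m * ‖Θ (v b)‖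

/-- Well-behaved Rota-Baxter algebras; the growth inequalities are required for the elements met
in the recursion. -/
def IsWellBehaved (ε : A →ₐ[ℝ] ℝ) (R : A →ₗ[ℝ] A) (θ σ : A → A) (Θ : A →ₐ[ℝ] ℂ) (γ : A)
    (v : A →* A) : Prop :=
  IsAverageAlgebra ε R θ σ Θ γ ∧ ∃ k : ℝ, 0 < k ∧ GrowthOn (recursionElements R γ) k R Θ γ v

end RotaBaxter

/-! ### The organic data on `ℝ[x, y]` -/

/-- The algebra `ℝ[x, y]`, with `x = X 0` and `y = X 1`. -/
abbrev Poly : Type := MvPolynomial (Fin 2) ℝ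

/-- `R (x ^ m y ^ n) = m / (m + n) x ^ (m + n)` if `m + n ≠ 0`, and `R 1 = 1`. -/
def organicR : Poly →ₗ[ℝ] Poly :=
  (MvPolynomial.basisMonomials (Fin 2) ℝ).constr ℝ fun s =>
    if s 0 + s 1 = 0 then 1
    else ((s 0 : ℝ) / ((s 0 : ℝ) + (s 1 : ℝ))) • (MvPolynomial.X 0 ^ (s 0 + s 1) : Poly)

/-- `P(x, y) ↦ P(x, x)`. -/
def organicTheta (P : Poly) : Poly :=
  MvPolynomial.aeval (fun _ => (MvPolynomial.X 0 : Poly)) P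

/-- `P(x, y) ↦ P(y, x)`. -/
def organicSigma (P : Poly) : Poly := MvPolynomial.rename (Equiv.swap (0 : Fin 2) 1) P

/-- `γ = x y`. -/
def organicGamma : Poly := MvPolynomial.X 0 * MvPolynomial.X 1

/-- `Θ (P) = P(1, 1)`. -/
def organicEval : Poly →ₐ[ℝ] ℂ := MvPolynomial.aeval fun _ => (1 : ℂ)

/-- The augmentation `P ↦ P(0, 0)`. -/
def organicEps : Poly →ₐ[ℝ] ℝ := MvPolynomial.aeval fun _ => (0 : ℝ)

/-- The elements of `Im R` with nonnegative coefficients. -/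
def organicCone : Set Poly :=
  {b | b ∈ LinearMap.range organicR ∧ ∀ s, 0 ≤ MvPolynomial.coeff s b}

/-- The organic average. -/
def phiOrganic : Hqsh →ₗ[ℝ] ℂ := atkPhi organicR organicEval organicGamma

end WBA

end

noncomputable section

namespace WBA

namespace Hqsh

/-! ### Words and products -/

/-! The Rota-Baxter relation of weight -1 mirrors the quasi-shuffle recursion, with `-x * y` playing
the part of the contraction `a + b`. Hence a form defined by `f (a w) = -R (γ ^ a * f w)` is
multiplicative (`recForm_mul`). Up to reversal of words, which is multiplicative, `F` is such a
form, so `φ = Θ ∘ F` is a character.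

Algebraic problem. Let `G` be the analogous form for `id - R`, and let `I = e + a`. The Rota-Baxter
relation gives the factorization `F * I * G = e` for convolution (`atkinson`). Under `Θ`, `I`
becomes `ι`. The average axioms show that `Θ ∘ G = φ ∘ rev` (`organicEval_comp_recForm_complR`): `R
∘ σ` turns `G` into `F ∘ rev`, and `θ` is invisible to `Θ`. So `φ * ι * (φ ∘ rev) = e`. Since `φ` is
real, `ψ = φ * ι` has inverse `conj φ ∘ rev`, and `φ⁻¹ * ψ = ι`.

Analytic problem. The arborification of a forest is homogeneous for the weight, so `F ∘ rev` sends
it to one term `c x ^ (2 ‖Φ‖)`. Grafting a root multiplies `c` by `-q` with `0 ≤ q ≤ 1`. Thus `φ ∘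
rev` is bounded by 1 on forests, and `φ⁻¹ = ι * (φ ∘ rev)`, whose value at a tree is `c (1 - q)`, is
bounded by 1 on trees. A bound on `φ` is recovered from `φ⁻¹ * φ = e` by a recursion over admissible
cuts, whose weighted number is at most `2 ^ ‖Φ‖` (`hasCuts`, `norm_arbForest_le_cutBound`). -/

/-- A linear map on the quasi-shuffle algebra is multiplicative as soon as it is so on words. -/
theorem map_mul_of_words {A : Type*} [CommRing A] [Algebra ℝ A] (f : Hqsh →ₗ[ℝ] A)
    (h : ∀ u v, f (word u * word v) = f (word u) * f (word v)) (x y : Hqsh) :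
    f (x * y) = f x * f y := by
  have h' : mulB.compr₂ f = (LinearMap.mul ℝ A).compl₁₂ f f := by
    refine hom_ext fun u => hom_ext fun v => ?_
    exact h u v
  exact LinearMap.congr_fun₂ h' x y

/-- Multiplicativity of a linear map, checked along the recursion defining the quasi-shuffle. -/
theorem map_mul_of_cons {A : Type*} [CommRing A] [Algebra ℝ A] (f : Hqsh →ₗ[ℝ] A)
    (h1 : f 1 = 1)
    (h : ∀ a b u v, f (word u * word (b :: v)) = f (word u) * f (word (b :: v)) →
      f (word (a :: u) * word v) = f (word (a :: u)) * f (word v) →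
      f (word u * word v) = f (word u) * f (word v) →
      f (consL a (word u * word (b :: v))) + f (consL b (word (a :: u) * word v)) +
        f (consL (a + b) (word u * word v)) = f (word (a :: u)) * f (word (b :: v)))
    (x y : Hqsh) : f (x * y) = f x * f y := by
  refine map_mul_of_words f (fun u v => ?_) x y
  induction u, v using qsh.induct with
  | case1 v => rw [← one_def, one_mul, h1, one_mul]
  | case2 a u => rw [← one_def, mul_one, h1, mul_one]
  | case3 a u b v e1 e2 e3 =>
    rw [← h a b u v e1 e2 e3, word_mul_word (a :: u) (b :: v), qsh, map_add, map_add]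
    simp only [word_mul_word]

/-- Right concatenation of a letter, `w ↦ w a`. -/
def snocL (a : ℕ+) : Hqsh →ₗ[ℝ] Hqsh := ofWords fun w => word (w ++ [a])

theorem snocL_word (a : ℕ+) (u : List ℕ+) : snocL a (word u) = word (u ++ [a]) := by
  simp [snocL]

theorem snocL_consL (a b : ℕ+) (x : Hqsh) : snocL b (consL a x) = consL a (snocL b x) := by
  have h : snocL b ∘ₗ consL a = consL a ∘ₗ snocL b :=
    hom_ext fun u => by simp [snocL, consL]
  exact LinearMap.congr_fun h x

/-- The quasi-shuffle product satisfies the recursion on the last letters. -/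
theorem qsh_snoc (u v : List ℕ+) (a b : ℕ+) :
    qsh (u ++ [a]) (v ++ [b]) =
      snocL a (qsh u (v ++ [b])) + snocL b (qsh (u ++ [a]) v) + snocL (a + b) (qsh u v) := by
  induction u, v using qsh.induct with
  | case1 v =>
    induction v with
    | nil => simp [qsh, consL_word, snocL_word, add_comm]
    | cons c v ih =>
      simp only [List.nil_append, List.cons_append] at ih ⊢
      simp only [qsh, map_add, snocL_consL, ih, consL_word, snocL_word, List.cons_append]
      abel
  | case2 c u =>
    -- The induction must descend to the empty word, so the fact that this word is nonempty is
    -- forgotten.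
    generalize c :: u = u
    induction u with
    | nil => simp [qsh, consL_word, snocL_word, add_comm]
    | cons c u ih =>
      simp only [List.nil_append, List.cons_append] at ih ⊢
      simp only [qsh, map_add, snocL_consL, ih, qsh_nil_right, consL_word, snocL_word,
        List.cons_append]
      abel
  | case3 c u d v e1 e2 e3 =>
    simp only [List.cons_append] at e1 e2 e3 ⊢
    simp only [qsh, map_add, snocL_consL, e1, e2, e3]
    abel

@[simp] theorem rev_word (w : List ℕ+) : rev (word w) = word w.reverse := by simp [rev]

theorem rev_consL (a : ℕ+) (x : Hqsh) : rev (consL a x) = snocL a (rev x) := by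
  have h : rev ∘ₗ consL a = snocL a ∘ₗ rev :=
    hom_ext fun u => by simp [snocL, consL]
  exact LinearMap.congr_fun h x

theorem rev_rev (x : Hqsh) : rev (rev x) = x := by
  have h : rev ∘ₗ rev = LinearMap.id := hom_ext fun u => by simp
  exact LinearMap.congr_fun h x

theorem rev_one : rev 1 = 1 := by simp [one_def]

/-- Reversal is multiplicative. -/
theorem rev_mul (x y : Hqsh) : rev (x * y) = rev x * rev y := by
  refine map_mul_of_cons rev rev_one (fun a b u v h1 h2 h3 => ?_) x y
  rw [rev_consL, rev_consL, rev_consL, h1, h2, h3]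
  simp only [rev_word, word_mul_word, List.reverse_cons, qsh_snoc]

/-! ### Convolution -/

section Convolution

variable {A : Type*} [Ring A] [Algebra ℝ A]

@[simp] theorem convOne_nil : convOne A (word []) = 1 := by simp [convOne]

@[simp] theorem convOne_cons (a : ℕ+) (w : List ℕ+) : convOne A (word (a :: w)) = 0 := by
  simp [convOne]

theorem conv_word (f g : Hqsh →ₗ[ℝ] A) (w : List ℕ+) : conv f g (word w) =
    ∑ i ∈ Finset.range (w.length + 1), f (word (w.take i)) * g (word (w.drop i)) := by
  simp [conv]

theorem conv_nil (f g : Hqsh →ₗ[ℝ] A) : conv f g (word []) = f (word []) * g (word []) := by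
  simp [conv_word]

theorem conv_cons (f g : Hqsh →ₗ[ℝ] A) (a : ℕ+) (w : List ℕ+) : conv f g (word (a :: w)) =
    f (word []) * g (word (a :: w)) + conv (f ∘ₗ consL a) g (word w) := by
  rw [conv_word, conv_word, List.length_cons, Finset.sum_range_succ', add_comm]
  simp [consL_word]

theorem conv_add_left (f f' g : Hqsh →ₗ[ℝ] A) : conv (f + f') g = conv f g + conv f' g :=
  hom_ext fun w => by simp [conv_word, add_mul, Finset.sum_add_distrib]

theorem conv_add_right (f g g' : Hqsh →ₗ[ℝ] A) : conv f (g + g') = conv f g + conv f g' :=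
  hom_ext fun w => by simp [conv_word, mul_add, Finset.sum_add_distrib]

theorem conv_sub_left (f f' g : Hqsh →ₗ[ℝ] A) : conv (f - f') g = conv f g - conv f' g :=
  hom_ext fun w => by simp [conv_word, sub_mul]

theorem conv_sub_right (f g g' : Hqsh →ₗ[ℝ] A) : conv f (g - g') = conv f g - conv f g' :=
  hom_ext fun w => by simp [conv_word, mul_sub]

theorem conv_mulLeft (r : A) (f g : Hqsh →ₗ[ℝ] A) :
    conv (LinearMap.mulLeft ℝ r ∘ₗ f) g = LinearMap.mulLeft ℝ r ∘ₗ conv f g :=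
  hom_ext fun w => by simp [conv_word, mul_assoc]

theorem conv_one_left (f : Hqsh →ₗ[ℝ] A) : conv (convOne A) f = f := by
  refine hom_ext fun w => ?_
  rw [conv_word, Finset.sum_eq_single 0]
  · simp
  · intro i hi h0
    rw [Finset.mem_range] at hi
    have : w.take i ≠ [] := by
      intro h
      rcases List.take_eq_nil_iff.mp h with h | h
      · exact h0 h
      · subst h; simp at hi; omega
    simp [convOne, this]
  · simp

theorem conv_one_right (f : Hqsh →ₗ[ℝ] A) : conv f (convOne A) = f := by
  refine hom_ext fun w => ?_
  rw [conv_word, Finset.sum_eq_single w.length]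
  · simp
  · intro i hi h0
    rw [Finset.mem_range] at hi
    have : w.drop i ≠ [] := by
      intro h
      have := List.drop_eq_nil_iff.mp h
      omega
    simp [convOne, this]
  · simp

theorem conv_comp_consL (f g : Hqsh →ₗ[ℝ] A) (a : ℕ+) : conv f g ∘ₗ consL a =
    LinearMap.mulLeft ℝ (f (word [])) ∘ₗ (g ∘ₗ consL a) + conv (f ∘ₗ consL a) g :=
  hom_ext fun w => by simp [consL_word, conv_cons]

theorem conv_consL (f g : Hqsh →ₗ[ℝ] A) (a : ℕ+) (x : Hqsh) : conv f g (consL a x) =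
    f (word []) * g (consL a x) + conv (f ∘ₗ consL a) g x :=
  LinearMap.congr_fun (conv_comp_consL f g a) x

/-- Induction on the first letter: removing it from a convolution replaces the left factor `f` by `f
∘ₗ consL a`, hence the generalization. -/
theorem conv_assoc (f g h : Hqsh →ₗ[ℝ] A) : conv (conv f g) h = conv f (conv g h) := by
  refine hom_ext fun w => ?_
  induction w generalizing f g with
  | nil => simp [conv_nil, mul_assoc]
  | cons a w ih =>
    rw [conv_cons, conv_cons, conv_comp_consL, conv_add_left, conv_mulLeft, LinearMap.add_apply, ih,
      conv_nil, conv_cons g h]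
    simp [mul_add, mul_assoc, add_assoc]

/-- A linear form with value `1` at the empty word can be cancelled in convolutions. -/
theorem conv_left_cancel {f g g' : Hqsh →ₗ[ℝ] A} (hf : f (word []) = 1)
    (h : conv f g = conv f g') : g = g' := by
  have h0 : conv f (g - g') = 0 := by rw [conv_sub_right, h, sub_self]
  suffices ∀ n, ∀ w : List ℕ+, w.length = n → (g - g') (word w) = 0 from
    sub_eq_zero.mp (hom_ext fun w => by simpa using this _ w rfl)
  intro n
  induction n using Nat.strong_induction_on with
  | _ n ih =>
    intro w hw
    have hs := LinearMap.congr_fun h0 (word w)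
    -- The cuts with a nonempty prefix evaluate `g - g'` at shorter suffixes, where it vanishes;
    -- only the term `f ∅ * (g - g') w` survives.
    rw [conv_word, Finset.sum_range_succ', Finset.sum_eq_zero] at hs
    · simpa [hf] using hs
    · intro i hi
      rw [Finset.mem_range] at hi
      rw [ih (n - (i + 1)) (by omega) _ (by rw [List.length_drop, hw]), mul_zero]

/-- A right inverse for convolution is an inverse. -/
theorem conv_comm_of_eq_one {f g : Hqsh →ₗ[ℝ] A} (hf : f (word []) = 1)
    (h : conv f g = convOne A) : conv g f = convOne A := by
  refine conv_left_cancel hf ?_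
  rw [← conv_assoc, h, conv_one_left, conv_one_right]

end Convolution

theorem comp_conv {A B : Type*} [Ring A] [Algebra ℝ A] [Ring B] [Algebra ℝ B] (Θ : A →ₐ[ℝ] B)
    (f g : Hqsh →ₗ[ℝ] A) :
    Θ.toLinearMap ∘ₗ conv f g = conv (Θ.toLinearMap ∘ₗ f) (Θ.toLinearMap ∘ₗ g) :=
  hom_ext fun w => by simp [conv_word]

theorem comp_convOne {A B : Type*} [Ring A] [Algebra ℝ A] [Ring B] [Algebra ℝ B]
    (Θ : A →ₐ[ℝ] B) : Θ.toLinearMap ∘ₗ convOne A = convOne B :=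
  hom_ext fun w => by cases w <;> simp

/-! ### Deconcatenation -/

section Coproduct

open TensorProduct

/-- The deconcatenation coproduct. -/
def deconc : Hqsh →ₗ[ℝ] Hqsh ⊗[ℝ] Hqsh :=
  conv (Algebra.TensorProduct.includeLeft : Hqsh →ₐ[ℝ] Hqsh ⊗[ℝ] Hqsh).toLinearMap
    (Algebra.TensorProduct.includeRight : Hqsh →ₐ[ℝ] Hqsh ⊗[ℝ] Hqsh).toLinearMap

theorem deconc_word (w : List ℕ+) : deconc (word w) =
    ∑ i ∈ Finset.range (w.length + 1), word (w.take i) ⊗ₜ[ℝ] word (w.drop i) := by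
  simp [deconc, conv_word]

/-- Through this form, multiplicativity of convolutions of characters follows from multiplicativity
of the coproduct. -/
theorem conv_eq_deconc {A : Type*} [CommRing A] [Algebra ℝ A] (f g : Hqsh →ₗ[ℝ] A) (x : Hqsh) :
    conv f g x = LinearMap.mul' ℝ A (TensorProduct.map f g (deconc x)) := by
  have h : conv f g = LinearMap.mul' ℝ A ∘ₗ TensorProduct.map f g ∘ₗ deconc :=
    hom_ext fun w => by simp [conv_word, deconc_word]
  exact LinearMap.congr_fun h x

/-- Left concatenation on the left tensor factor. -/
def consT (a : ℕ+) : Hqsh ⊗[ℝ] Hqsh →ₗ[ℝ] Hqsh ⊗[ℝ] Hqsh := TensorProduct.map (consL a) LinearMap.id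

theorem consT_mul_consT (a b : ℕ+) (X Y : Hqsh ⊗[ℝ] Hqsh) : consT a X * consT b Y =
    consT a (X * consT b Y) + consT b (consT a X * Y) + consT (a + b) (X * Y) := by
  induction X using TensorProduct.induction_on with
  | zero => simp
  | add X X' h h' => simp only [map_add, add_mul, h, h']; abel
  | tmul x x' =>
    induction Y using TensorProduct.induction_on with
    | zero => simp
    | add Y Y' h h' => simp only [map_add, mul_add, h, h']; abel
    | tmul y y' => simp [consT, consL_mul_consL, TensorProduct.add_tmul]

theorem consT_mul_tmul (a : ℕ+) (X : Hqsh ⊗[ℝ] Hqsh) (y : Hqsh) :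
    consT a X * (1 ⊗ₜ y) = consT a (X * (1 ⊗ₜ y)) := by
  induction X using TensorProduct.induction_on with
  | zero => simp
  | add X X' h h' => simp only [map_add, add_mul, h, h']
  | tmul x x' => simp [consT]

theorem deconc_consL (a : ℕ+) (x : Hqsh) :
    deconc (consL a x) = 1 ⊗ₜ consL a x + consT a (deconc x) := by
  have h : deconc ∘ₗ consL a = TensorProduct.mk ℝ Hqsh Hqsh 1 ∘ₗ consL a + consT a ∘ₗ deconc := by
    refine hom_ext fun w => ?_
    simp only [LinearMap.comp_apply, LinearMap.add_apply, consL_word, deconc_word, List.length_cons,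
      Finset.sum_range_succ' _ (w.length + 1)]
    simp [consT, consL_word, one_def, add_comm]
  exact LinearMap.congr_fun h x

theorem deconc_one : deconc 1 = 1 := by
  rw [one_def, deconc_word]
  simp [← one_def, Algebra.TensorProduct.one_def]

/-- Deconcatenation is multiplicative. -/
theorem deconc_mul (x y : Hqsh) : deconc (x * y) = deconc x * deconc y := by
  refine map_mul_of_cons deconc deconc_one (fun a b u v h1 h2 h3 => ?_) x y
  -- The terms with empty left factor are not reached by the recursion for `consT`; their product
  -- obeys the quasi-shuffle recursion in the right factor.
  have hone : (1 : Hqsh) ⊗ₜ[ℝ] (consL a (word u) * consL b (word v)) =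
    (1 ⊗ₜ consL a (word u)) * (1 ⊗ₜ consL b (word v)) := by simp
  rw [consL_mul_consL, TensorProduct.tmul_add, TensorProduct.tmul_add] at hone
  simp only [← consL_word] at h1 h2 ⊢
  simp only [deconc_consL] at h1 h2 ⊢
  rw [h1, h2, h3]
  simp only [mul_add, add_mul, map_add]
  rw [consT_mul_consT, ← hone, consT_mul_tmul,
    mul_comm (1 ⊗ₜ[ℝ] consL a (word u)) (consT b _), consT_mul_tmul, mul_comm (deconc (word v))]
  abel

/-- The convolution of two multiplicative maps is multiplicative. -/
theorem conv_mul {A : Type*} [CommRing A] [Algebra ℝ A] {f g : Hqsh →ₗ[ℝ] A}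
    (hf : ∀ x y, f (x * y) = f x * f y) (hg : ∀ x y, g (x * y) = g x * g y) (x y : Hqsh) :
    conv f g (x * y) = conv f g x * conv f g y := by
  simp only [conv_eq_deconc, deconc_mul]
  generalize deconc x = X
  generalize deconc y = Y
  induction X using TensorProduct.induction_on with
  | zero => simp
  | add X X' h h' => simp only [map_add, add_mul, h, h']
  | tmul x x' =>
    induction Y using TensorProduct.induction_on with
    | zero => simp
    | add Y Y' h h' => simp only [map_add, mul_add, h, h']
    | tmul y y' => simp [hf, hg]; ring

end Coproduct

end Hqsh

open Hqsh

/-! ### The Atkinson recursion -/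

section Atkinson

variable {A : Type*} [CommRing A] [Algebra ℝ A]

@[simp] theorem atkA_nil (γ : A) : atkA γ (word []) = 0 := by simp [atkA, calI]

@[simp] theorem atkA_singleton (γ : A) (a : ℕ+) : atkA γ (word [a]) = γ ^ (a : ℕ) := by
  simp [atkA, calI]

@[simp] theorem atkA_cons_cons (γ : A) (a b : ℕ+) (w : List ℕ+) :
    atkA γ (word (a :: b :: w)) = 0 := by
  simp [atkA, calI]

theorem calI_eq (γ : A) : calI γ = convOne A + atkA γ := by simp [atkA]

theorem calI_one (γ : A) : calI γ 1 = 1 := by simp [one_def, calI]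

theorem conv_atkA_snoc (f : Hqsh →ₗ[ℝ] A) (γ : A) (w : List ℕ+) (a : ℕ+) :
    conv f (atkA γ) (word (w ++ [a])) = f (word w) * γ ^ (a : ℕ) := by
  induction w generalizing f with
  | nil => simp [conv_cons, conv_nil]
  | cons b w ih =>
    have h : atkA γ (word (b :: (w ++ [a]))) = 0 := by cases w <;> simp
    rw [List.cons_append, conv_cons, h, ih, mul_zero, zero_add, LinearMap.comp_apply, consL_word]

theorem atkA_comp_consL (γ : A) (a : ℕ+) :
    atkA γ ∘ₗ consL a = LinearMap.mulLeft ℝ (γ ^ (a : ℕ)) ∘ₗ convOne A :=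
  hom_ext fun w => by cases w <;> simp [consL_word]

theorem conv_atkA_cons (g : Hqsh →ₗ[ℝ] A) (γ : A) (a : ℕ+) (w : List ℕ+) :
    conv (atkA γ) g (word (a :: w)) = γ ^ (a : ℕ) * g (word w) := by
  simp [conv_cons, atkA_comp_consL, conv_mulLeft, conv_one_left]

/-- The linear map with `f ∅ = 1` and `f (a w) = - R (γ ^ a f w)`. -/
def recForm (R : A →ₗ[ℝ] A) (γ : A) : Hqsh →ₗ[ℝ] A :=
  ofWords fun w => w.foldr (fun a b => -R (γ ^ (a : ℕ) * b)) 1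

@[simp] theorem recForm_nil (R : A →ₗ[ℝ] A) (γ : A) : recForm R γ (word []) = 1 := by
  simp [recForm]

theorem recForm_one (R : A →ₗ[ℝ] A) (γ : A) : recForm R γ 1 = 1 := recForm_nil R γ

theorem recForm_cons (R : A →ₗ[ℝ] A) (γ : A) (a : ℕ+) (w : List ℕ+) :
    recForm R γ (word (a :: w)) = -R (γ ^ (a : ℕ) * recForm R γ (word w)) := by
  simp [recForm]

theorem recForm_consL (R : A →ₗ[ℝ] A) (γ : A) (a : ℕ+) (x : Hqsh) :
    recForm R γ (consL a x) = -R (γ ^ (a : ℕ) * recForm R γ x) := by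
  have h : recForm R γ ∘ₗ consL a =
      -(R ∘ₗ LinearMap.mulLeft ℝ (γ ^ (a : ℕ)) ∘ₗ recForm R γ) :=
    hom_ext fun w => by simp [consL_word, recForm_cons]
  exact LinearMap.congr_fun h x

theorem IsRotaBaxter.mul {R : A →ₗ[ℝ] A} (hR : IsRotaBaxter (-1) R) (x y : A) :
    R x * R y = R (R x * y + x * R y - x * y) := by
  rw [hR, neg_one_smul, sub_eq_add_neg]

theorem complR_apply (R : A →ₗ[ℝ] A) (x : A) : complR R x = x - R x := rfl

theorem IsRotaBaxter.complR {R : A →ₗ[ℝ] A} (hR : IsRotaBaxter (-1) R) :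
    IsRotaBaxter (-1) (complR R) := by
  intro x y
  have h := hR.mul x y
  have e : (x - R x) * y + x * (y - R y) + (-1 : ℝ) • (x * y) =
      -(R x * y + x * R y - x * y) := by
    rw [neg_one_smul]; ring
  simp only [complR_apply]
  rw [e, map_neg, ← h]
  ring

/-- The solution of a Rota-Baxter recursion is multiplicative. -/
theorem recForm_mul {R : A →ₗ[ℝ] A} (hR : IsRotaBaxter (-1) R) (γ : A) (x y : Hqsh) :
    recForm R γ (x * y) = recForm R γ x * recForm R γ y := by
  refine map_mul_of_cons _ (recForm_one R γ) (fun a b u v h1 h2 h3 => ?_) x y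
  -- The three quasi-shuffle terms match the three terms of the Rota-Baxter relation for `γ ^ a * f
  -- u` and `γ ^ b * f v`; the contraction contributes `γ ^ (a + b) = γ ^ a * γ ^ b`.
  rw [recForm_consL, recForm_consL, recForm_consL, h1, h2, h3, recForm_cons, recForm_cons,
    neg_mul_neg, hR.mul, ← neg_add, ← neg_add, ← map_add, ← map_add, ← map_neg, PNat.add_coe,
    pow_add]
  congr 1
  ring

theorem bracketPow_snoc (R : A →ₗ[ℝ] A) (γ : A) (n : ℕ) (w : List ℕ+) (a : ℕ+) :
    bracketPow R (atkA γ) (n + 1) (word (w ++ [a])) =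
      R (bracketPow R (atkA γ) n (word w) * γ ^ (a : ℕ)) := by
  rw [bracketPow, LinearMap.comp_apply, conv_atkA_snoc]

theorem atkF_word (R : A →ₗ[ℝ] A) (γ : A) (w : List ℕ+) : atkF R γ (word w) =
    ∑ n ∈ Finset.range (w.length + 1), (-1 : ℝ) ^ n • bracketPow R (atkA γ) n (word w) := by
  simp [atkF]

@[simp] theorem atkF_nil (R : A →ₗ[ℝ] A) (γ : A) : atkF R γ (word []) = 1 := by
  simp [atkF_word, bracketPow]

theorem atkF_snoc (R : A →ₗ[ℝ] A) (γ : A) (w : List ℕ+) (a : ℕ+) :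
    atkF R γ (word (w ++ [a])) = -R (atkF R γ (word w) * γ ^ (a : ℕ)) := by
  -- With no term at `n = 0`, the sum shifts by one index; the shift of `(-1) ^ n` produces the
  -- minus sign.
  have h0 : bracketPow R (atkA γ) 0 (word (w ++ [a])) = 0 := by
    simp [bracketPow, convOne]
  rw [atkF_word, atkF_word, List.length_append, List.length_singleton, Finset.sum_range_succ', h0,
    Finset.sum_mul, map_sum, ← Finset.sum_neg_distrib, smul_zero, add_zero]
  refine Finset.sum_congr rfl fun n _ => ?_
  rw [bracketPow_snoc, smul_mul_assoc, map_smul, pow_succ, mul_neg_one, neg_smul]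

/-- `F` consumes words from the last letter and `recForm` from the first; commutativity of `A` makes
the two recursions agree after reversal. -/
theorem atkF_comp_rev (R : A →ₗ[ℝ] A) (γ : A) : atkF R γ ∘ₗ rev = recForm R γ := by
  refine hom_ext fun w => ?_
  induction w with
  | nil => simp
  | cons a w ih =>
    rw [LinearMap.comp_apply, rev_word] at ih ⊢
    rw [List.reverse_cons, atkF_snoc, ih, recForm_cons, mul_comm]

theorem atkF_rev (R : A →ₗ[ℝ] A) (γ : A) (x : Hqsh) : atkF R γ (rev x) = recForm R γ x :=
  LinearMap.congr_fun (atkF_comp_rev R γ) x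

theorem atkF_eq (R : A →ₗ[ℝ] A) (γ : A) :
    atkF R γ = convOne A - R ∘ₗ conv (atkF R γ) (atkA γ) := by
  refine hom_ext fun w => ?_
  induction w using List.reverseRecOn with
  | nil => simp [conv_nil]
  | append_singleton w a => simp [atkF_snoc, conv_atkA_snoc, convOne]

theorem recForm_eq (R : A →ₗ[ℝ] A) (γ : A) :
    recForm R γ = convOne A - R ∘ₗ conv (atkA γ) (recForm R γ) := by
  refine hom_ext fun w => ?_
  cases w with
  | nil => simp [conv_nil]
  | cons a w => simp [recForm_cons, conv_atkA_cons]

/-! ### The Atkinson factorization -/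

theorem IsRotaBaxter.conv_complR {R : A →ₗ[ℝ] A} (hR : IsRotaBaxter (-1) R)
    (U V : Hqsh →ₗ[ℝ] A) : conv (R ∘ₗ U) (WBA.complR R ∘ₗ V) =
      R ∘ₗ conv U (WBA.complR R ∘ₗ V) + WBA.complR R ∘ₗ conv (R ∘ₗ U) V := by
  refine hom_ext fun w => ?_
  simp only [LinearMap.add_apply, LinearMap.comp_apply, conv_word, map_sum,
    ← Finset.sum_add_distrib]
  refine Finset.sum_congr rfl fun i _ => ?_
  -- Factorization by factorization, this is `R u * R̃ v = R (u * R̃ v) + R̃ (R u * v)`, a rewriting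
  -- of the Rota-Baxter relation.
  have h := hR.mul (U (word (w.take i))) (V (word (w.drop i)))
  simp only [complR_apply, mul_sub, map_sub, map_add] at h ⊢
  rw [h]
  abel

/-- The Atkinson factorization. -/
theorem atkinson {R : A →ₗ[ℝ] A} (hR : IsRotaBaxter (-1) R) (γ : A) :
    conv (atkF R γ) (conv (calI γ) (recForm (complR R) γ)) = convOne A := by
  set F := atkF R γ with hF
  set G := recForm (complR R) γ with hG
  set a := atkA γ with ha
  have eF : R ∘ₗ conv F a = convOne A - F := by
    have := atkF_eq R γ
    rw [← hF] at this
    nth_rewrite 2 [this]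
    abel
  have eG : complR R ∘ₗ conv a G = convOne A - G := by
    have := recForm_eq (complR R) γ
    rw [← hG] at this
    nth_rewrite 2 [this]
    abel
  -- The left side is `(e - F) * (e - G)`. On the right, `R + R̃ = id` merges the two terms in `F *
  -- a * G`, leaving `2 e - F - G - F * a * G`. Hence `F * G + F * a * G = e`.
  have h := hR.conv_complR (conv F a) (conv a G)
  rw [eF, eG, conv_sub_right (conv F a), conv_sub_left _ F (conv a G), conv_one_left,
    conv_one_right, LinearMap.comp_sub, LinearMap.comp_sub, eF, eG, conv_assoc] at h
  have hid : R ∘ₗ conv F (conv a G) + complR R ∘ₗ conv F (conv a G) = conv F (conv a G) := by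
    refine LinearMap.ext fun x => ?_
    simp [complR_apply]
  rw [conv_sub_left, conv_one_left, conv_sub_right, conv_one_right] at h
  rw [calI_eq, ← ha, conv_add_left, conv_one_left, conv_add_right]
  nth_rewrite 1 [← hid]
  rw [← sub_eq_zero] at h ⊢
  refine Eq.trans ?_ h
  abel

end Atkinson

/-! ### Multiplicativity of `e` and `I` -/

/-- The form `e` is multiplicative. -/
theorem convOne_mul (A : Type*) [CommRing A] [Algebra ℝ A] (x y : Hqsh) :
    convOne A (x * y) = convOne A x * convOne A y := by
  have hc : ∀ (a : ℕ+) (z : Hqsh), convOne A (consL a z) = 0 := fun a z =>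
    LinearMap.congr_fun (hom_ext fun w => by simp [consL_word] : convOne A ∘ₗ consL a = 0) z
  refine map_mul_of_cons _ convOne_nil (fun a b u v _ _ _ => ?_) x y
  simp [hc]

/-- The form `I` is multiplicative. -/
theorem calI_mul {A : Type*} [CommRing A] [Algebra ℝ A] (γ : A) (x y : Hqsh) :
    calI γ (x * y) = calI γ x * calI γ y := by
  have hc : ∀ (a : ℕ+) (z : Hqsh), calI γ (consL a z) = γ ^ (a : ℕ) * convOne A z := fun a z =>
    LinearMap.congr_fun (hom_ext fun w => by cases w <;> simp [consL_word, calI] :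
      calI γ ∘ₗ consL a = LinearMap.mulLeft ℝ (γ ^ (a : ℕ)) ∘ₗ convOne A) z
  refine map_mul_of_cons _ (calI_one γ) (fun a b u v _ _ _ => ?_) x y
  -- Both shuffle terms die, since `e` vanishes on nonempty words; the contraction alone gives the
  -- product.
  rw [hc, hc, hc, convOne_mul, convOne_mul, convOne_mul, convOne_cons, convOne_cons,
    ← consL_word, hc, ← consL_word, hc, PNat.add_coe, pow_add]
  ring

open TensorProduct

/-! ### Gradings, and cuts of forests -/

namespace Hqsh

/-- The sum of the letters of a word. -/
def weight (w : List ℕ+) : ℕ := (w.map fun a : ℕ+ => (a : ℕ)).sum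

@[simp] theorem weight_nil : weight [] = 0 := rfl

@[simp] theorem weight_cons (a : ℕ+) (w : List ℕ+) : weight (a :: w) = a + weight w := by
  simp [weight]

/-- The span of the words of weight `n`. -/
def homog (n : ℕ) : Submodule ℝ Hqsh := Submodule.span ℝ (word '' {w | weight w = n})

theorem word_mem_homog (w : List ℕ+) : word w ∈ homog (weight w) :=
  Submodule.subset_span ⟨w, rfl, rfl⟩

theorem consL_mem_homog (a : ℕ+) {n : ℕ} {x : Hqsh} (hx : x ∈ homog n) :
    consL a x ∈ homog (a + n) := by
  have h : homog n ≤ (homog (a + n)).comap (consL a) := by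
    refine Submodule.span_le.mpr ?_
    rintro _ ⟨w, rfl, rfl⟩
    change consL a (word w) ∈ homog _
    rw [consL_word, ← weight_cons]
    exact word_mem_homog _
  exact h hx

theorem qsh_mem_homog (u v : List ℕ+) : qsh u v ∈ homog (weight u + weight v) := by
  induction u, v using qsh.induct with
  | case1 v => simpa [qsh] using word_mem_homog v
  | case2 a u => simpa [qsh] using word_mem_homog (a :: u)
  | case3 a u b v h1 h2 h3 =>
    rw [qsh]
    refine add_mem (add_mem ?_ ?_) ?_
    · convert consL_mem_homog a h1 using 2
      simp [add_assoc]
    · convert consL_mem_homog b h2 using 2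
      simp; ring
    · convert consL_mem_homog (a + b) h3 using 2
      simp; ring

theorem mul_mem_homog {m n : ℕ} {x y : Hqsh} (hx : x ∈ homog m) (hy : y ∈ homog n) :
    x * y ∈ homog (m + n) := by
  have h1 : ∀ u, weight u = m → homog n ≤ (homog (m + n)).comap (mulB (word u)) := by
    rintro u rfl
    refine Submodule.span_le.mpr ?_
    rintro _ ⟨v, rfl, rfl⟩
    change word u * word v ∈ homog _
    rw [word_mul_word]
    exact qsh_mem_homog u v
  have h2 : homog m ≤ (homog (m + n)).comap (mulB.flip y) := by
    refine Submodule.span_le.mpr ?_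
    rintro _ ⟨u, hu, rfl⟩
    exact h1 u hu hy
  exact h2 hx

end Hqsh

theorem Tree.norm_graft (η : ℕ+) (F : Forest) : (graft η F).norm = η + Forest.norm F := by
  rw [Tree.norm, Tree.fold_graft]
  rfl

@[simp] theorem Forest.norm_zero : Forest.norm 0 = 0 := rfl

@[simp] theorem Forest.norm_cons (T : Tree) (F : Forest) :
    Forest.norm (T ::ₘ F) = T.norm + Forest.norm F := by simp [Forest.norm]

@[simp] theorem Forest.norm_singleton (T : Tree) : Forest.norm {T} = T.norm := by
  simp [Forest.norm]

theorem Forest.norm_add (F G : Forest) : Forest.norm (F + G) = F.norm + G.norm := by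
  simp [Forest.norm]

theorem Forest.norm_le_of_mem {T : Tree} {F : Forest} (h : T ∈ F) : T.norm ≤ Forest.norm F :=
  Multiset.single_le_sum (fun _ _ => Nat.zero_le _) _ (Multiset.mem_map_of_mem _ h)

/-- The value of the arborification at a forest. -/
def arbForest (F : Forest) : Hqsh := (F.map arbTree).prod

@[simp] theorem arbForest_zero : arbForest 0 = 1 := rfl

@[simp] theorem arbForest_cons (T : Tree) (F : Forest) :
    arbForest (T ::ₘ F) = arbTree T * arbForest F := by simp [arbForest]

theorem arbForest_add (F G : Forest) : arbForest (F + G) = arbForest F * arbForest G := by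
  simp [arbForest]

@[simp] theorem arbForest_singleton (T : Tree) : arbForest {T} = arbTree T := by simp [arbForest]

theorem arbTree_graft (η : ℕ+) (F : Forest) : arbTree (graft η F) = consL η (arbForest F) := by
  rw [arbTree, Tree.fold_graft]
  rfl

theorem arbForest_mem_of_forall (F : Forest) (h : ∀ T ∈ F, arbTree T ∈ homog T.norm) :
    arbForest F ∈ homog F.norm := by
  induction F using Multiset.induction with
  | empty => exact word_mem_homog []
  | cons T F ih =>
    rw [arbForest_cons, Forest.norm_cons]
    exact mul_mem_homog (h T (Multiset.mem_cons_self T F))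
      (ih fun S hS => h S (Multiset.mem_cons_of_mem hS))

theorem arbTree_mem_homog (T : Tree) : arbTree T ∈ homog T.norm := by
  induction T using Tree.induction with
  | h η F ih =>
    rw [arbTree_graft, Tree.norm_graft]
    exact consL_mem_homog η (arbForest_mem_of_forall F ih)

theorem arbForest_mem_homog (F : Forest) : arbForest F ∈ homog F.norm :=
  arbForest_mem_of_forall F fun T _ => arbTree_mem_homog T

/-! ### Admissible cuts and the growth criterion -/

/-- The product over the trees of a forest of `2 ^ ‖T‖ / 2`. -/
def Forest.cutBound (F : Forest) : ℝ := (F.map fun T => (2 : ℝ) ^ T.norm / 2).prod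

theorem Forest.cutBound_add (F G : Forest) : (F + G).cutBound = F.cutBound * G.cutBound := by
  simp [Forest.cutBound]

theorem Forest.cutBound_nonneg (F : Forest) : 0 ≤ F.cutBound :=
  Multiset.prod_nonneg fun x hx => by
    obtain ⟨T, -, rfl⟩ := Multiset.mem_map.mp hx
    positivity

theorem Forest.cutBound_le (F : Forest) : F.cutBound ≤ 2 ^ F.norm := by
  induction F using Multiset.induction with
  | empty => simp [Forest.cutBound]
  | cons T F ih =>
    rw [← Multiset.singleton_add, Forest.cutBound_add, Forest.norm_add, pow_add]
    refine mul_le_mul ?_ ih (Forest.cutBound_nonneg F) (by positivity)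
    simp only [Forest.cutBound, Multiset.map_singleton, Multiset.prod_singleton,
      Forest.norm_singleton]
    exact half_le_self (by positivity)

/-- The admissible cuts of a forest: its arborification deconcatenates into arborifications of
pairs of forests, whose lower parts are controlled. -/
def HasCuts (F : Forest) : Prop :=
  ∃ (κ : Type) (_ : Fintype κ) (P Q : κ → Forest),
    deconc (arbForest F) = ∑ i, arbForest (P i) ⊗ₜ[ℝ] arbForest (Q i) ∧
    ∑ i, (Q i).cutBound ≤ 2 ^ F.norm ∧ ∀ i, (Q i).norm ≤ F.norm

theorem HasCuts.zero : HasCuts 0 :=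
  ⟨Unit, inferInstance, fun _ => 0, fun _ => 0, by simp [deconc_one, Algebra.TensorProduct.one_def],
    by simp [Forest.cutBound], by simp⟩

theorem HasCuts.add {F G : Forest} (hF : HasCuts F) (hG : HasCuts G) : HasCuts (F + G) := by
  obtain ⟨κ, _, P, Q, h1, h2, h3⟩ := hF
  obtain ⟨κ', _, P', Q', h1', h2', h3'⟩ := hG
  refine ⟨κ × κ', inferInstance, fun i => P i.1 + P' i.2, fun i => Q i.1 + Q' i.2, ?_, ?_, ?_⟩
  · rw [arbForest_add, deconc_mul, h1, h1', Finset.sum_mul_sum, Fintype.sum_prod_type]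
    simp [arbForest_add]
  · simp only [Fintype.sum_prod_type, Forest.cutBound_add, ← Finset.sum_mul_sum,
      Forest.norm_add, pow_add]
    exact mul_le_mul h2 h2' (Finset.sum_nonneg fun i _ => Forest.cutBound_nonneg _) (by positivity)
  · intro i
    rw [Forest.norm_add, Forest.norm_add]
    exact add_le_add (h3 _) (h3' _)

theorem HasCuts.of_forall (F : Forest) (h : ∀ T ∈ F, HasCuts {T}) : HasCuts F := by
  induction F using Multiset.induction with
  | empty => exact HasCuts.zero
  | cons T F ih =>
    rw [← Multiset.singleton_add]
    exact (h T (Multiset.mem_cons_self T F)).add (ih fun S hS => h S (Multiset.mem_cons_of_mem hS))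

/-- The root has decoration at least 1, which pays for the factor 1/2 in `cutBound`. -/
theorem two_pow_norm_le_graft (η : ℕ+) (F : Forest) :
    (2 : ℝ) ^ F.norm ≤ 2 ^ (graft η F).norm / 2 := by
  rw [le_div_iff₀ two_pos, ← pow_succ, Tree.norm_graft]
  exact pow_le_pow_right₀ one_le_two (by have := η.pos; omega)

theorem HasCuts.graft {F : Forest} (η : ℕ+) (hF : HasCuts F) : HasCuts {graft η F} := by
  obtain ⟨κ, _, P, Q, h1, h2, h3⟩ := hF
  -- The index `none` is the cut placing the whole tree in the lower part; every other cut of the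
  -- tree keeps the root above a cut of `F`.
  refine ⟨Option κ, inferInstance, fun i => i.elim 0 fun i => {WBA.graft η (P i)},
    fun i => i.elim {WBA.graft η F} Q, ?_, ?_, ?_⟩
  · rw [arbForest_singleton, arbTree_graft, deconc_consL, h1, Fintype.sum_option, map_sum]
    simp [arbTree_graft, consT]
  · rw [Fintype.sum_option]
    have h4 := two_pow_norm_le_graft η F
    have h5 : Forest.cutBound {WBA.graft η F} = 2 ^ (WBA.graft η F).norm / 2 := by
      simp [Forest.cutBound]
    simp only [Option.elim, Forest.norm_singleton, h5]
    -- The total cut and the cuts of `F` each contribute at most `2 ^ ‖T‖ / 2`; this is why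
    -- `cutBound` carries the halves.
    linarith
  · rintro (_ | i)
    · exact le_rfl
    · rw [Forest.norm_singleton, Tree.norm_graft]
      exact (h3 i).trans (Nat.le_add_left _ _)

theorem hasCuts (F : Forest) : HasCuts F :=
  HasCuts.of_forall F fun T _ =>
    Tree.induction (fun η F ih => (HasCuts.of_forall F ih).graft η) T

/-- Bounds on trees give bounds on forests for multiplicative forms. -/
theorem norm_arbForest_le {f : Hqsh →ₗ[ℝ] ℂ} (hf : IsCharacter f) (B : Tree → ℝ) (F : Forest)
    (h : ∀ T ∈ F, ‖f (arbTree T)‖ ≤ B T) : ‖f (arbForest F)‖ ≤ (F.map B).prod := by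
  induction F using Multiset.induction with
  | empty => simp [hf.1]
  | cons T F ih =>
    rw [arbForest_cons, hf.2, norm_mul, Multiset.map_cons, Multiset.prod_cons]
    have hT := h T (Multiset.mem_cons_self T F)
    exact mul_le_mul hT (ih fun S hS => h S (Multiset.mem_cons_of_mem hS)) (norm_nonneg _)
      ((norm_nonneg _).trans hT)

/-- A character whose convolution inverse is bounded by `1` at the arborifications of trees has
geometric growth on forests. -/
theorem norm_arbForest_le_cutBound {h φ : Hqsh →ₗ[ℝ] ℂ} (hφ : IsCharacter φ) (h1 : h 1 = 1)
    (hinv : conv h φ = convOne ℂ) (hh : ∀ T, ‖h (arbTree T)‖ ≤ 1) (F : Forest) :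
    ‖φ (arbForest F)‖ ≤ F.cutBound := by
  suffices ∀ n, ∀ T : Tree, T.norm = n → ‖φ (arbTree T)‖ ≤ 2 ^ T.norm / 2 from
    norm_arbForest_le hφ _ F fun T _ => this _ T rfl
  intro n
  induction n using Nat.strong_induction_on with
  | _ n ih =>
    intro T hT
    induction T using Tree.induction with
    | h η F _ =>
      obtain ⟨κ, _, P, Q, e1, e2, e3⟩ := hasCuts F
      -- Expanding this zero along the first letter gives `φ T = -∑ h (B⁺_η P i) * φ (Q i)`. Only
      -- values of `h` at trees occur, and each `Q i` has norm smaller than `T`.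
      have h0 : conv h φ (consL η (arbForest F)) = 0 := by
        rw [hinv]
        exact LinearMap.congr_fun (hom_ext fun w => by simp [consL_word] :
          convOne ℂ ∘ₗ consL η = 0) _
      rw [conv_consL, ← one_def, h1, one_mul, ← arbTree_graft, conv_eq_deconc, e1, map_sum, map_sum,
        add_eq_zero_iff_eq_neg] at h0
      rw [h0, norm_neg]
      refine (norm_sum_le _ _).trans (le_trans (Finset.sum_le_sum fun i _ => ?_)
        (e2.trans (two_pow_norm_le_graft η F)))
      rw [TensorProduct.map_tmul, LinearMap.mul'_apply, LinearMap.comp_apply, ← arbTree_graft,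
        norm_mul]
      refine (mul_le_of_le_one_left (norm_nonneg _) (hh _)).trans
        (norm_arbForest_le hφ _ _ fun S hS => ih _ ?_ S rfl)
      have h6 := Forest.norm_le_of_mem hS
      have h7 := e3 i
      have h8 := η.pos
      rw [Tree.norm_graft] at hT
      omega

/-! ### The organic operator on monomials -/

/-- The monomial `x ^ m y ^ n`. -/
def mon (m n : ℕ) : Poly := MvPolynomial.X 0 ^ m * MvPolynomial.X 1 ^ n

theorem mon_zero : mon 0 0 = 1 := by simp [mon]

theorem mon_mul_mon (m n p q : ℕ) : mon m n * mon p q = mon (m + p) (n + q) := by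
  simp only [mon]; ring

theorem monomial_eq_smul_mon (s : Fin 2 →₀ ℕ) (c : ℝ) :
    (MvPolynomial.monomial s c : Poly) = c • mon (s 0) (s 1) := by
  rw [MvPolynomial.monomial_eq, MvPolynomial.C_mul', Finsupp.prod_fintype _ _ (by simp),
    Fin.prod_univ_two, mon]

theorem poly_induction {p : Poly → Prop} (hmon : ∀ m n, p (mon m n))
    (hadd : ∀ x y, p x → p y → p (x + y)) (hsmul : ∀ (c : ℝ) x, p x → p (c • x)) (x : Poly) :
    p x := by
  induction x using MvPolynomial.induction_on' with
  | monomial s c => rw [monomial_eq_smul_mon]; exact hsmul _ _ (hmon _ _)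
  | add x y hx hy => exact hadd x y hx hy

/-- The coefficient of `R (x ^ m y ^ n)`. -/
def organicCoeff (m n : ℕ) : ℝ := if m + n = 0 then 1 else (m : ℝ) / ((m : ℝ) + (n : ℝ))

theorem organicCoeff_of_ne {m n : ℕ} (h : m + n ≠ 0) :
    organicCoeff m n = (m : ℝ) / ((m : ℝ) + (n : ℝ)) := if_neg h

theorem organicCoeff_zero : organicCoeff 0 0 = 1 := rfl

theorem organicCoeff_zero_right (m : ℕ) : organicCoeff m 0 = 1 := by
  rcases Nat.eq_zero_or_pos m with rfl | h
  · rfl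
  · rw [organicCoeff_of_ne (by omega)]
    simp [h.ne']

theorem organicCoeff_nonneg (m n : ℕ) : 0 ≤ organicCoeff m n := by
  unfold organicCoeff
  split_ifs <;> positivity

theorem organicCoeff_le_one (m n : ℕ) : organicCoeff m n ≤ 1 := by
  unfold organicCoeff
  split_ifs
  · exact le_rfl
  · exact div_le_one_of_le₀ (by simp) (by positivity)

theorem organicR_mon (m n : ℕ) : organicR (mon m n) = organicCoeff m n • mon (m + n) 0 := by
  have h0 : (Finsupp.single 0 m + Finsupp.single 1 n : Fin 2 →₀ ℕ) 0 = m := by simp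
  have h1 : (Finsupp.single 0 m + Finsupp.single 1 n : Fin 2 →₀ ℕ) 1 = n := by simp
  have h : mon m n = MvPolynomial.basisMonomials (Fin 2) ℝ
      (Finsupp.single 0 m + Finsupp.single 1 n) := by
    rw [MvPolynomial.coe_basisMonomials]
    beta_reduce
    rw [monomial_eq_smul_mon, h0, h1, one_smul]
  rw [h, organicR, Module.Basis.constr_basis, h0, h1, organicCoeff]
  split_ifs with h2
  · rw [h2, mon_zero, one_smul]
  · simp [mon]

theorem organicSigma_mon (m n : ℕ) : organicSigma (mon m n) = mon n m := by
  simp [organicSigma, mon, mul_comm]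

theorem organicSigma_add (x y : Poly) : organicSigma (x + y) = organicSigma x + organicSigma y := by
  simp [organicSigma]

theorem organicSigma_sub (x y : Poly) : organicSigma (x - y) = organicSigma x - organicSigma y := by
  simp [organicSigma]

theorem organicSigma_neg (x : Poly) : organicSigma (-x) = -organicSigma x := by
  simp [organicSigma]

theorem organicSigma_smul (c : ℝ) (x : Poly) : organicSigma (c • x) = c • organicSigma x := by
  simp [organicSigma]

theorem organicSigma_mul (x y : Poly) : organicSigma (x * y) = organicSigma x * organicSigma y := by
  simp [organicSigma]

theorem organicTheta_mon (m n : ℕ) : organicTheta (mon m n) = mon (m + n) 0 := by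
  simp [organicTheta, mon, pow_add]

theorem organicTheta_add (x y : Poly) : organicTheta (x + y) = organicTheta x + organicTheta y := by
  simp [organicTheta]

theorem organicTheta_sub (x y : Poly) : organicTheta (x - y) = organicTheta x - organicTheta y := by
  simp [organicTheta]

theorem organicTheta_smul (c : ℝ) (x : Poly) : organicTheta (c • x) = c • organicTheta x := by
  simp [organicTheta]

theorem organicEval_mon (m n : ℕ) : organicEval (mon m n) = 1 := by simp [organicEval, mon]

theorem organicEval_theta (x : Poly) : organicEval (organicTheta x) = organicEval x := by
  induction x using poly_induction with
  | hmon m n => rw [organicTheta_mon, organicEval_mon, organicEval_mon]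
  | hadd x y hx hy => rw [organicTheta_add, map_add, map_add, hx, hy]
  | hsmul c x hx => rw [organicTheta_smul, map_smul, map_smul, hx]

theorem organicEps_mon (m n : ℕ) : organicEps (mon m n) = if m + n = 0 then 1 else 0 := by
  by_cases hm : m = 0 <;> by_cases hn : n = 0 <;> simp [organicEps, mon, hm, hn]

theorem organicGamma_pow (k : ℕ) : organicGamma ^ k = mon k k := by
  simp [organicGamma, mon, mul_pow]

theorem organicEps_gamma : organicEps organicGamma = 0 := by simp [organicEps, organicGamma]

/-! ### The Rota-Baxter and average identities -/

theorem organicR_idempotent (x : Poly) : organicR (organicR x) = organicR x := by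
  induction x using poly_induction with
  | hmon m n =>
    rw [organicR_mon, map_smul, organicR_mon, organicCoeff_zero_right, one_smul, add_zero]
  | hadd x y hx hy => rw [map_add, map_add, hx, hy]
  | hsmul c x hx => rw [map_smul, map_smul, hx]

/-- With `d = m + n`, `e = p + q` both nonzero, multiplying the right side by `d + e` leaves `m p /
d + m p / e = m p (d + e) / (d e)`. If `d` or `e` is zero, the convention `R 1 = 1` makes the
identity trivial. -/
theorem organicCoeff_rotaBaxter (m n p q : ℕ) : organicCoeff m n * organicCoeff p q =
    organicCoeff m n * organicCoeff (m + n + p) q + organicCoeff p q * organicCoeff (m + (p + q)) n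
      - organicCoeff (m + p) (n + q) := by
  by_cases h : m + n = 0
  · obtain ⟨rfl, rfl⟩ : m = 0 ∧ n = 0 := by omega
    simp [organicCoeff_zero_right]
  by_cases h' : p + q = 0
  · obtain ⟨rfl, rfl⟩ : p = 0 ∧ q = 0 := by omega
    simp [organicCoeff_zero_right]
  have e1 : (m : ℝ) + n ≠ 0 := by exact_mod_cast h
  have e2 : (p : ℝ) + q ≠ 0 := by exact_mod_cast h'
  have e3 : (m : ℝ) + n + p + q ≠ 0 := by norm_cast; omega
  have e4 : (m : ℝ) + (p + q) + n ≠ 0 := by norm_cast; omega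
  have e5 : (m : ℝ) + p + (n + q) ≠ 0 := by norm_cast; omega
  rw [organicCoeff_of_ne h, organicCoeff_of_ne h', organicCoeff_of_ne (by omega),
    organicCoeff_of_ne (by omega), organicCoeff_of_ne (by omega)]
  push_cast
  rw [show (m : ℝ) + (p + q) + n = m + n + p + q by ring,
    show (m : ℝ) + p + (n + q) = m + n + p + q by ring]
  field_simp
  ring

theorem organicR_rotaBaxter : IsRotaBaxter (-1) organicR := by
  intro x y
  rw [neg_one_smul, ← sub_eq_add_neg]
  induction x using poly_induction with
  | hadd x x' h h' =>
    rw [show (organicR (x + x') * y + (x + x') * organicR y - (x + x') * y) =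
      (organicR x * y + x * organicR y - x * y) +
        (organicR x' * y + x' * organicR y - x' * y) by rw [map_add]; ring, map_add _ _ (_ - _),
      ← h, ← h', map_add, add_mul]
  | hsmul c x h =>
    rw [map_smul, smul_mul_assoc, smul_mul_assoc, smul_mul_assoc, smul_mul_assoc, ← smul_add,
      ← smul_sub, map_smul, h]
  | hmon m n =>
    induction y using poly_induction with
    | hadd x x' h h' =>
      rw [show (organicR (mon m n) * (x + x') + mon m n * organicR (x + x') - mon m n * (x + x')) =
        (organicR (mon m n) * x + mon m n * organicR x - mon m n * x) +
          (organicR (mon m n) * x' + mon m n * organicR x' - mon m n * x') by rw [map_add]; ring,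
        map_add _ _ (_ - _), ← h, ← h', map_add, mul_add]
    | hsmul c x h =>
      rw [map_smul, mul_smul_comm, mul_smul_comm, mul_smul_comm, mul_smul_comm, ← smul_add,
        ← smul_sub, map_smul, h]
    | hmon p q =>
      simp only [organicR_mon, smul_mul_assoc, mul_smul_comm, mon_mul_mon, map_add, map_sub,
        map_smul, smul_smul]
      rw [show m + n + p + (0 + q) = m + n + (p + q) by ring,
        show m + (p + q) + (n + 0) = m + n + (p + q) by ring,
        show m + p + (n + q) = m + n + (p + q) by ring, zero_add, zero_add, add_zero,
        ← add_smul, ← sub_smul, mul_comm (organicCoeff p q), organicCoeff_rotaBaxter,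
        mul_comm (organicCoeff p q)]

/-- On the augmentation ideal, `θ ∘ (id - R) = R ∘ σ`. -/
theorem organicTheta_complR {b : Poly} (hb : organicEps b = 0) :
    organicTheta (complR organicR b) = organicR (organicSigma b) := by
  -- Stating the defect as `ε b • 1` makes the claim linear in `b`, so that monomials suffice.
  suffices h : ∀ b, organicR (organicSigma b) - organicTheta (complR organicR b) =
      organicEps b • (1 : Poly) by
    have := h b
    rw [hb, zero_smul] at this
    exact (sub_eq_zero.mp this).symm
  intro b
  induction b using poly_induction with
  | hadd x y hx hy =>
    rw [organicSigma_add, map_add, map_add, organicTheta_add, map_add, add_smul, ← hx, ← hy]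
    ring
  | hsmul c x hx =>
    rw [organicSigma_smul, map_smul, map_smul, organicTheta_smul, map_smul, smul_assoc, ← hx,
      smul_sub]
  | hmon m n =>
    rw [complR_apply, organicTheta_sub, organicR_mon, organicTheta_smul, organicTheta_mon,
      organicTheta_mon, organicSigma_mon, organicR_mon, organicEps_mon, add_zero, add_comm n m]
    by_cases h : m + n = 0
    · obtain ⟨rfl, rfl⟩ : m = 0 ∧ n = 0 := by omega
      simp [organicCoeff_zero, mon_zero]
    · have e1 : (m : ℝ) + n ≠ 0 := by exact_mod_cast h
      have e2 : organicCoeff n m + organicCoeff m n = 1 := by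
        rw [organicCoeff_of_ne h, organicCoeff_of_ne (by omega), add_comm (n : ℝ), ← add_div,
          add_comm (n : ℝ), div_self e1]
      rw [if_neg h, zero_smul, ← sub_add, sub_add_eq_add_sub, ← add_smul, e2, one_smul, sub_self]

/-- On the augmentation ideal, `R ∘ σ ∘ R = 0`. -/
theorem organicR_sigma_R {b : Poly} (hb : organicEps b = 0) :
    organicR (organicSigma (organicR b)) = 0 := by
  suffices h : ∀ b, organicR (organicSigma (organicR b)) = organicEps b • (1 : Poly) by
    rw [h b, hb, zero_smul]
  intro b
  induction b using poly_induction with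
  | hadd x y hx hy => rw [map_add, organicSigma_add, map_add, map_add, add_smul, hx, hy]
  | hsmul c x hx => rw [map_smul, organicSigma_smul, map_smul, map_smul, smul_assoc, hx]
  | hmon m n =>
    rw [organicR_mon, organicSigma_smul, organicSigma_mon, map_smul, organicR_mon, organicEps_mon,
      smul_smul]
    by_cases h : m + n = 0
    · obtain ⟨rfl, rfl⟩ : m = 0 ∧ n = 0 := by omega
      simp [organicCoeff_zero, mon_zero]
    -- `R` outputs a power of `x`, which `σ` turns into a power of `y`, and `R` kills positive
    -- powers of `y`.
    · rw [if_neg h, organicCoeff_of_ne (m := 0) (by omega)]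
      simp

/-- For `b = x ^ m y ^ n` and `d = m + n ≠ 0`, everything is a multiple of `x ^ (d + 2 k)`. Up to
the factor `1 / (d + 2 k)`, the coefficient is `(k + n) - m k / d - n (k + d) / d = 0`. -/
theorem organicR_gamma_mul_complR_sigma (b : Poly) (k : ℕ) :
    organicR (organicGamma ^ k * complR organicR (organicSigma (complR organicR b))) = 0 := by
  induction b using poly_induction with
  | hadd x y hx hy => rw [map_add, organicSigma_add, map_add, mul_add, map_add, hx, hy, add_zero]
  | hsmul c x hx => rw [map_smul, organicSigma_smul, map_smul, mul_smul_comm, map_smul, hx, smul_zero]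
  | hmon m n =>
    by_cases h : m + n = 0
    · obtain ⟨rfl, rfl⟩ : m = 0 ∧ n = 0 := by omega
      simp [complR_apply, organicR_mon, organicCoeff_zero, organicSigma]
    have h' : m + n + k + k ≠ 0 := by omega
    have e1 : (m : ℝ) + n ≠ 0 := by exact_mod_cast h
    have e2 : (m : ℝ) + n + k + k ≠ 0 := by exact_mod_cast h'
    simp only [complR_apply, organicR_mon, organicSigma_sub, organicSigma_smul, organicSigma_mon,
      map_sub, map_smul, mul_sub, mul_smul_comm, organicGamma_pow, mon_mul_mon, smul_smul]
    rw [show k + n + (k + m) = m + n + k + k by ring,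
      show k + 0 + (k + (m + n)) = m + n + k + k by ring,
      show k + (n + m) + (k + 0) = m + n + k + k by ring,
      show k + (0 + (m + n)) + (k + 0) = m + n + k + k by ring]
    simp only [smul_smul, ← sub_smul]
    refine smul_eq_zero_of_left ?_ (mon (m + n + k + k) 0)
    rw [organicCoeff_of_ne h, organicCoeff_of_ne (m := k + n) (by omega),
      organicCoeff_of_ne (m := k + 0) (by omega), organicCoeff_of_ne (m := n) (by omega),
      organicCoeff_of_ne (m := 0) (by omega), organicCoeff_of_ne (m := k + (n + m)) (by omega)]
    push_cast
    rw [show (k : ℝ) + n + (k + m) = m + n + k + k by ring,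
      show (k : ℝ) + 0 + (k + (m + n)) = m + n + k + k by ring, add_comm (n : ℝ) m,
      zero_div, zero_mul, sub_zero]
    field_simp
    ring

/-! ### The organic average -/

theorem organicSigma_gamma_pow (k : ℕ) :
    organicSigma (organicGamma ^ k) = organicGamma ^ k := by
  rw [organicGamma_pow, organicSigma_mon]

theorem isAverageAlgebra_organic : IsAverageAlgebra organicEps organicR organicTheta organicSigma
    organicEval organicGamma where
  rotaBaxter := organicR_rotaBaxter
  idempotent := organicR_idempotent
  sigma_mul b _ n := by rw [organicSigma_mul, organicSigma_gamma_pow]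
  Theta_gamma := by rw [← pow_one organicGamma, organicGamma_pow, organicEval_mon]
  eps_gamma := organicEps_gamma
  theta_compl b hb := by rw [organicTheta_complR hb, sub_self]; exact zero_mem _
  sigma_gamma := by simpa using organicSigma_gamma_pow 1
  compl_sigma := by
    rintro _ ⟨c, rfl⟩ n
    exact organicR_gamma_mul_complR_sigma c n

/-! ### Homogeneous values and the growth inequalities -/

theorem organicR_gamma_pow_mul (k e : ℕ) (c : ℝ) :
    organicR (organicGamma ^ k * c • mon (2 * e) 0) =
      (c * organicCoeff (k + 2 * e) k) • mon (2 * (k + e)) 0 := by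
  rw [organicGamma_pow, mul_smul_comm, mon_mul_mon, map_smul, organicR_mon, smul_smul, add_zero,
    show k + 2 * e + k = 2 * (k + e) by ring]

theorem organicEval_smul_mon (c : ℝ) (m n : ℕ) : organicEval (c • mon m n) = c := by
  rw [map_smul, organicEval_mon]
  simp

theorem exists_eq_smul_mon_of_homog {f : Hqsh →ₗ[ℝ] Poly}
    (hf : ∀ w, ∃ c : ℝ, f (word w) = c • mon (2 * weight w) 0) {n : ℕ} {x : Hqsh}
    (hx : x ∈ homog n) : ∃ c : ℝ, f x = c • mon (2 * n) 0 := by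
  have h : homog n ≤ (Submodule.span ℝ {mon (2 * n) 0}).comap f := by
    refine Submodule.span_le.mpr ?_
    rintro _ ⟨w, rfl, rfl⟩
    obtain ⟨c, hc⟩ := hf w
    exact Submodule.mem_span_singleton.mpr ⟨c, hc.symm⟩
  obtain ⟨c, hc⟩ := Submodule.mem_span_singleton.mp (h hx)
  exact ⟨c, hc.symm⟩

theorem bracePow_organic (n : ℕ) (w : List ℕ+) : ∃ c : ℝ,
    bracePow organicR (atkA organicGamma) n (word w) = c • mon (2 * weight w) 0 := by
  induction n generalizing w with
  | zero =>
    cases w with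
    | nil => exact ⟨1, by simp [bracePow, mon_zero]⟩
    | cons a w => exact ⟨0, by simp [bracePow]⟩
  | succ n ih =>
    cases w with
    | nil => exact ⟨0, by simp [bracePow, conv_nil]⟩
    | cons a w =>
      obtain ⟨c, hc⟩ := ih w
      refine ⟨c * organicCoeff (a + 2 * weight w) a, ?_⟩
      rw [bracePow, LinearMap.comp_apply, conv_atkA_cons, hc, organicR_gamma_pow_mul, weight_cons]

theorem recForm_organic (w : List ℕ+) : ∃ c : ℝ,
    recForm organicR organicGamma (word w) = c • mon (2 * weight w) 0 := by
  induction w with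
  | nil => exact ⟨1, by simp [mon_zero]⟩
  | cons a w ih =>
    obtain ⟨c, hc⟩ := ih
    refine ⟨-(c * organicCoeff (a + 2 * weight w) a), ?_⟩
    rw [recForm_cons, hc, organicR_gamma_pow_mul, weight_cons, neg_smul]

/-- Homogeneity leaves no room for cancellation: each element is a single term `c x ^ (2 ‖Φ‖)`, and
`R (γ ^ m * ·)` scales `c` by a factor in `[0, 1]`. -/
theorem growthOn_recursionElements_organic : GrowthOn (recursionElements organicR organicGamma) 1
    organicR organicEval organicGamma (MonoidHom.id Poly) := by
  rintro m b ⟨F, hF⟩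
  refine ⟨le_rfl, ?_⟩
  obtain ⟨c, hc⟩ : ∃ c : ℝ, b = c • mon (2 * F.norm) 0 := by
    have hx : arborification (forest F) ∈ homog F.norm := by
      rw [arborification_forest]
      exact arbForest_mem_homog F
    rcases hF with ⟨n, rfl⟩ | rfl
    · exact exists_eq_smul_mon_of_homog (bracePow_organic n) hx
    · rw [atkF_rev]
      exact exists_eq_smul_mon_of_homog recForm_organic hx
  rw [hc, MonoidHom.id_apply, MonoidHom.id_apply, organicR_gamma_pow_mul, organicEval_smul_mon,
    organicEval_smul_mon, one_pow, one_mul, Complex.norm_real, Complex.norm_real, norm_mul,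
    Real.norm_of_nonneg (organicCoeff_nonneg _ _)]
  exact mul_le_of_le_one_right (norm_nonneg _) (organicCoeff_le_one _ _)

theorem growthOn_organicCone : GrowthOn organicCone 1 organicR organicEval organicGamma
    (MonoidHom.id Poly) := by
  rintro m b ⟨-, hb⟩
  refine ⟨le_rfl, ?_⟩
  -- With nonnegative coefficients, both evaluations are nonnegative reals, so the comparison is
  -- additive over monomials.
  obtain ⟨t, u, hu, hut, ht, hu'⟩ : ∃ t u : ℝ, 0 ≤ u ∧ u ≤ t ∧ organicEval b = t ∧
      organicEval (organicR (organicGamma ^ m * b)) = u := by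
    rw [← MvPolynomial.support_sum_monomial_coeff b]
    refine Finset.sum_induction _ (fun p => ∃ t u : ℝ, 0 ≤ u ∧ u ≤ t ∧ organicEval p = t ∧
      organicEval (organicR (organicGamma ^ m * p)) = u) ?_ ⟨0, 0, by simp⟩ fun s _ => ?_
    · rintro p q ⟨t, u, h1, h2, h3, h4⟩ ⟨t', u', h1', h2', h3', h4'⟩
      refine ⟨t + t', u + u', add_nonneg h1 h1', add_le_add h2 h2', ?_, ?_⟩
      · rw [map_add, h3, h3', Complex.ofReal_add]
      · rw [mul_add, map_add, map_add, h4, h4', Complex.ofReal_add]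
    · refine ⟨b.coeff s, b.coeff s * organicCoeff (m + s 0) (m + s 1),
        mul_nonneg (hb s) (organicCoeff_nonneg _ _),
        mul_le_of_le_one_right (hb s) (organicCoeff_le_one _ _), ?_, ?_⟩
      · rw [monomial_eq_smul_mon, organicEval_smul_mon]
      · rw [monomial_eq_smul_mon, organicGamma_pow, mul_smul_comm, mon_mul_mon, map_smul,
          organicR_mon, smul_smul, organicEval_smul_mon]
  rw [MonoidHom.id_apply, MonoidHom.id_apply, ht, hu', one_pow, one_mul, Complex.norm_real,
    Complex.norm_real]
  rwa [Real.norm_of_nonneg hu, Real.norm_of_nonneg (hu.trans hut)]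

/-! ### The closed form -/

theorem atkF_organic (w : List ℕ+) : atkF organicR organicGamma (word w) =
    (∏ i ∈ Finset.range w.length, ((((w.getD i 1 : ℕ+) : ℕ) : ℝ) /
      (2 * (weight (w.take (i + 1)) : ℝ)) - 1)) • mon (2 * weight w) 0 := by
  induction w using List.reverseRecOn with
  | nil => simp [mon_zero]
  | append_singleton w a ih =>
    have hw : weight (w ++ [a]) = a + weight w := by simp [weight, add_comm]
    have ha : ((a : ℕ) : ℝ) ≠ 0 := by simp
    rw [atkF_snoc, ih, mul_comm, organicR_gamma_pow_mul, ← neg_smul, ← mul_neg, List.length_append,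
      List.length_singleton, Finset.prod_range_succ, hw]
    congr 2
    · refine Finset.prod_congr rfl fun i hi => ?_
      rw [Finset.mem_range] at hi
      -- Here `i` is a valid index, so the default letter 1 is never read.
      rw [List.getD_append _ _ _ _ hi, List.take_append_of_le_length hi]
    · have h1 : w.length + 1 = (w ++ [a]).length := by simp
      have h2 : (w ++ [a]).getD w.length 1 = a := by simp
      have h3 : ((a : ℕ) : ℝ) + weight w ≠ 0 := by
        have := a.pos
        norm_cast
        omega
      have h4 : ((a : ℕ) : ℝ) + 2 * weight w + (a : ℕ) ≠ 0 := by
        have := a.pos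
        norm_cast
        omega
      -- With `W` the weight of `w`, the new factor is `-(a + 2 W) / (2 a + 2 W) = a / (2 (a + W)) -
      -- 1`.
      rw [h2, h1, List.take_length, hw, organicCoeff_of_ne (by have := a.pos; omega)]
      push_cast
      field_simp
      ring

theorem phiOrganic_word_real (w : List ℕ+) : phiOrganic (word w) =
    ((∏ i ∈ Finset.range w.length, ((((w.getD i 1 : ℕ+) : ℕ) : ℝ) /
      (2 * (weight (w.take (i + 1)) : ℝ)) - 1) : ℝ) : ℂ) := by
  rw [phiOrganic, atkPhi, LinearMap.comp_apply, atkF_organic]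
  exact organicEval_smul_mon _ _ _

theorem phiOrganic_word (w : List ℕ+) : phiOrganic (word w) =
    ∏ i : Fin w.length, (((w.get i : ℕ) : ℂ) /
      (2 * (((w.take (i.val + 1)).map fun ω : ℕ+ => ((ω : ℕ) : ℂ)).sum)) - 1) := by
  rw [phiOrganic_word_real, Finset.prod_range, Complex.ofReal_prod]
  refine Finset.prod_congr rfl fun i _ => ?_
  have h : ((weight (w.take (i.val + 1)) : ℕ) : ℂ) =
      ((w.take (i.val + 1)).map fun ω : ℕ+ => ((ω : ℕ) : ℂ)).sum := by
    rw [weight, Nat.cast_list_sum, List.map_map]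
    rfl
  rw [List.getD_eq_getElem _ _ i.2, List.get_eq_getElem, ← h]
  push_cast
  rfl

/-! ### The algebraic problem -/

theorem conjForm_phiOrganic : conjForm phiOrganic = phiOrganic :=
  hom_ext fun w => by
    rw [conjForm, LinearMap.comp_apply, phiOrganic_word_real]
    exact Complex.conj_ofReal _

theorem organicEval_gamma_pow (k : ℕ) : organicEval (organicGamma ^ k) = 1 := by
  rw [organicGamma_pow, organicEval_mon]

theorem organicEval_comp_calI : organicEval.toLinearMap ∘ₗ calI organicGamma = iota :=
  hom_ext fun w => by
    match w with
    | [] => simp [calI, iota]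
    | [a] => simp [calI, iota, -map_pow, organicEval_gamma_pow]
    | a :: b :: w => simp [calI, iota]

theorem phiOrganic_comp_rev :
    phiOrganic ∘ₗ rev = organicEval.toLinearMap ∘ₗ recForm organicR organicGamma := by
  rw [phiOrganic, atkPhi, LinearMap.comp_assoc, atkF_comp_rev]

theorem organicEps_gamma_pow_mul (a : ℕ+) (x : Poly) :
    organicEps (organicGamma ^ (a : ℕ) * x) = 0 := by
  rw [map_mul, map_pow, organicEps_gamma, zero_pow a.ne_zero, zero_mul]

/-- Since `R σ R` vanishes on `ker ε`, `R σ G (a w) = -R (γ ^ a * σ G w)`. The vanishing of `R (γ ^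
a * R̃ σ G w)` then replaces `σ G w` by `R σ G w`, and both sides obey the same recursion. -/
theorem organicR_sigma_recForm (w : List ℕ+) :
    organicR (organicSigma (recForm (complR organicR) organicGamma (word w))) =
      recForm organicR organicGamma (word w) := by
  induction w with
  | nil =>
    rw [recForm_nil, recForm_nil, ← mon_zero, organicSigma_mon, organicR_mon, organicCoeff_zero,
      one_smul]
  | cons a w ih =>
    set G := recForm (complR organicR) organicGamma with hG
    -- For nonempty `w`, `G w` lies in the image of `R̃`; the value `G ∅ = 1` does not come from the
    -- recursion and is checked directly.
    have hk : organicR (organicGamma ^ (a : ℕ) *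
        complR organicR (organicSigma (G (word w)))) = 0 := by
      cases w with
      | nil => simp [hG, complR_apply, ← mon_zero, organicSigma_mon, organicR_mon,
          organicCoeff_zero]
      | cons b w =>
        rw [hG, recForm_cons, ← map_neg]
        exact organicR_gamma_mul_complR_sigma _ _
    rw [complR_apply, mul_sub, map_sub, sub_eq_zero, ih] at hk
    rw [hG, recForm_cons, ← hG, complR_apply, organicSigma_neg, organicSigma_sub, map_neg, map_sub,
      organicR_sigma_R (organicEps_gamma_pow_mul _ _), sub_zero, organicSigma_mul,
      organicSigma_gamma_pow, hk, recForm_cons]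

/-- For `b = γ ^ a * G w` in `ker ε`, `Θ (R̃ b) = Θ (θ (R̃ b)) = Θ (R σ b) = Θ (R σ R̃ b)`, so `Θ ∘
G = Θ ∘ R ∘ σ ∘ G`. -/
theorem organicEval_comp_recForm_complR :
    organicEval.toLinearMap ∘ₗ recForm (complR organicR) organicGamma = phiOrganic ∘ₗ rev := by
  rw [phiOrganic_comp_rev]
  refine hom_ext fun w => ?_
  rw [LinearMap.comp_apply, LinearMap.comp_apply, AlgHom.toLinearMap_apply,
    AlgHom.toLinearMap_apply, ← organicR_sigma_recForm]
  cases w with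
  | nil => rw [recForm_nil, ← mon_zero, organicSigma_mon, organicR_mon, organicCoeff_zero, one_smul]
  | cons a w =>
    rw [recForm_cons, organicSigma_neg, map_neg, map_neg, map_neg, ← organicEval_theta,
      organicTheta_complR (organicEps_gamma_pow_mul _ _), complR_apply, organicSigma_sub, map_sub,
      organicR_sigma_R (organicEps_gamma_pow_mul _ _), sub_zero]

theorem isCharacter_phiOrganic_comp_rev : IsCharacter (phiOrganic ∘ₗ rev) := by
  rw [phiOrganic_comp_rev]
  refine ⟨by simp [recForm_one], fun x y => ?_⟩
  simp [recForm_mul organicR_rotaBaxter]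

/-- Reversal is a multiplicative involution, so the character property of `φ ∘ rev` passes to `φ`.
-/
theorem isCharacter_phiOrganic : IsCharacter phiOrganic := by
  have h := isCharacter_phiOrganic_comp_rev
  refine ⟨by simpa [rev_one] using h.1, fun x y => ?_⟩
  simpa [rev_mul, rev_rev] using h.2 (rev x) (rev y)

theorem isCharacter_iota : IsCharacter iota := by
  rw [← organicEval_comp_calI]
  exact ⟨by simp [calI_one], fun x y => by simp [calI_mul]⟩

theorem IsCharacter.conv {f g : Hqsh →ₗ[ℝ] ℂ} (hf : IsCharacter f) (hg : IsCharacter g) :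
    IsCharacter (conv f g) := by
  refine ⟨?_, conv_mul hf.2 hg.2⟩
  rw [one_def, conv_nil, ← one_def, hf.1, hg.1, one_mul]

theorem conv_phiOrganic :
    conv phiOrganic (conv iota (phiOrganic ∘ₗ rev)) = convOne ℂ := by
  have h := congrArg (organicEval.toLinearMap ∘ₗ ·) (atkinson organicR_rotaBaxter organicGamma)
  simp only [comp_conv, comp_convOne, organicEval_comp_calI, organicEval_comp_recForm_complR] at h
  exact h

theorem isConvInverse_phiOrganic :
    IsConvInverse phiOrganic (conv iota (phiOrganic ∘ₗ rev)) :=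
  ⟨conv_phiOrganic, conv_comm_of_eq_one isCharacter_phiOrganic.1 conv_phiOrganic⟩

theorem solvesAlgebraicProblem_phiOrganic : SolvesAlgebraicProblem phiOrganic := by
  have hψ := isCharacter_phiOrganic.conv isCharacter_iota
  have h : conv (conv phiOrganic iota) (phiOrganic ∘ₗ rev) = convOne ℂ := by
    rw [conv_assoc, conv_phiOrganic]
  refine ⟨isCharacter_phiOrganic, conv iota (phiOrganic ∘ₗ rev), conv phiOrganic iota,
    isCharacter_iota.conv isCharacter_phiOrganic_comp_rev, hψ, isConvInverse_phiOrganic, ?_, ?_⟩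
  · rw [conjForm_phiOrganic]
    exact ⟨h, conv_comm_of_eq_one hψ.1 h⟩
  · rw [← conv_assoc, isConvInverse_phiOrganic.2, conv_one_left]

/-! ### The analytic problem -/

/-- The values at `F` and at `B⁺_η F` of the character `φ ∘ rev ∘ α`. -/
theorem exists_phiOrganic_rev_graft (η : ℕ+) (F : Forest) : ∃ c q : ℝ, 0 ≤ q ∧ q ≤ 1 ∧
    (phiOrganic ∘ₗ rev) (arbForest F) = c ∧
    (phiOrganic ∘ₗ rev) (arbTree (graft η F)) = -(c * q : ℝ) := by
  obtain ⟨c, hc⟩ := exists_eq_smul_mon_of_homog recForm_organic (arbForest_mem_homog F)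
  refine ⟨c, organicCoeff (η + 2 * F.norm) η, organicCoeff_nonneg _ _, organicCoeff_le_one _ _, ?_,
    ?_⟩
  · rw [phiOrganic_comp_rev, LinearMap.comp_apply, hc]
    exact organicEval_smul_mon _ _ _
  · rw [phiOrganic_comp_rev, LinearMap.comp_apply, arbTree_graft, recForm_consL, hc,
      organicR_gamma_pow_mul, map_neg]
    exact congrArg _ (organicEval_smul_mon _ _ _)

theorem norm_phiOrganic_rev_arbForest (F : Forest) : ‖(phiOrganic ∘ₗ rev) (arbForest F)‖ ≤ 1 := by
  have key : ∀ F : Forest, (∀ T ∈ F, ‖(phiOrganic ∘ₗ rev) (arbTree T)‖ ≤ 1) →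
      ‖(phiOrganic ∘ₗ rev) (arbForest F)‖ ≤ 1 := fun F h => by
    simpa using norm_arbForest_le isCharacter_phiOrganic_comp_rev (fun _ => 1) F h
  refine key F fun T _ => Tree.induction (p := fun T => ‖(phiOrganic ∘ₗ rev) (arbTree T)‖ ≤ 1)
    (fun η F ih => ?_) T
  obtain ⟨c, q, hq, hq', h1, h2⟩ := exists_phiOrganic_rev_graft η F
  have h3 := key F ih
  rw [h1, Complex.norm_real] at h3
  rw [h2, norm_neg, Complex.norm_real, norm_mul, Real.norm_of_nonneg hq]
  exact mul_le_one₀ h3 hq hq'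

/-- At `η x`, `ι` only sees prefixes of length at most one, leaving the values of `φ ∘ rev` at `η x`
and at `x`. They have opposite signs when nonzero: `-c q + c = c (1 - q)`. -/
theorem norm_conv_iota_arbTree (T : Tree) :
    ‖conv iota (phiOrganic ∘ₗ rev) (arbTree T)‖ ≤ 1 := by
  refine Tree.induction (p := fun T => ‖conv iota (phiOrganic ∘ₗ rev) (arbTree T)‖ ≤ 1)
    (fun η F _ => ?_) T
  obtain ⟨c, q, hq, hq', h1, h2⟩ := exists_phiOrganic_rev_graft η F
  have h3 := norm_phiOrganic_rev_arbForest F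
  have hι : iota ∘ₗ consL η = convOne ℂ :=
    hom_ext fun w => by cases w <;> simp [consL_word, iota]
  rw [arbTree_graft, conv_consL, hι, conv_one_left, ← arbTree_graft, ← one_def,
    isCharacter_iota.1, one_mul, h1, h2, ← Complex.ofReal_neg, ← Complex.ofReal_add,
    show -(c * q) + c = c * (1 - q) by ring, Complex.norm_real, norm_mul,
    Real.norm_of_nonneg (sub_nonneg.mpr hq')]
  rw [h1, Complex.norm_real] at h3
  exact mul_le_one₀ h3 (sub_nonneg.mpr hq') (sub_le_self 1 hq)

theorem hasGeometricGrowth_phiOrganic :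
    HasGeometricGrowth (contractedArborification phiOrganic) := by
  refine ⟨1, 2, one_pos, two_pos, fun F => ?_⟩
  rw [one_mul, contractedArborification, LinearMap.comp_apply, AlgHom.toLinearMap_apply,
    arborification_forest]
  exact (norm_arbForest_le_cutBound isCharacter_phiOrganic
    (isCharacter_iota.conv isCharacter_phiOrganic_comp_rev).1 isConvInverse_phiOrganic.2
    norm_conv_iota_arbTree F).trans F.cutBound_le

end WBA

end

theorem mainTheorem8 :
    -- the seven-uple is a well-behaved Rota-Baxter algebra
    WBA.IsWellBehaved WBA.organicEps WBA.organicR WBA.organicTheta WBA.organicSigma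
      WBA.organicEval WBA.organicGamma (MonoidHom.id WBA.Poly) ∧
    -- the growth inequalities hold, with constant one, on all of `Im R ∩ ℝ₊[x, y]`
    WBA.GrowthOn WBA.organicCone 1 WBA.organicR WBA.organicEval WBA.organicGamma
      (MonoidHom.id WBA.Poly) ∧
    -- the closed form of the organic average
    (∀ w : List ℕ+, WBA.phiOrganic (WBA.Hqsh.word w) =
      ∏ i : Fin w.length, (((w.get i : ℕ) : ℂ) /
        (2 * (((w.take (i.val + 1)).map fun ω : ℕ+ => ((ω : ℕ) : ℂ)).sum)) - 1)) ∧
    -- the organic average solves both problems of averages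
    WBA.SolvesAlgebraicProblem WBA.phiOrganic ∧
    WBA.SolvesAnalyticProblem WBA.phiOrganic :=
  ⟨⟨WBA.isAverageAlgebra_organic, 1, one_pos, WBA.growthOn_recursionElements_organic⟩,
    WBA.growthOn_organicCone, WBA.phiOrganic_word, WBA.solvesAlgebraicProblem_phiOrganic,
    WBA.solvesAlgebraicProblem_phiOrganic, WBA.hasGeometricGrowth_phiOrganic⟩
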